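/- Let $1<p<+\infty$, $p'=\frac{p}{p-1}$, $\beta\in\mathbb R$ and $s_0>0$. Consider the eigenvalue problem \[ \begin{cases} (|X'|^{p-2}X')'+\mu |X|^{p-2}X=0 & \text{in }(0,s_0),\\ |X'(0)|^{p-2}X'(0)=0,\\ |X'(s_0)|^{p-2}X'(s_0)+\beta |X(s_0)|^{p-2}X(s_0)=0, \end{cases} \qquad (1) \] in the weak sense: $\mu\in\mathbb R$ is an eigenvalue with eigenfunction $X\in W^{1,p}(0,s_0)\setminus\{0\}$ if \[ \int_0^{s_0}|X'|^{p-2}X'\varphi'\,ds+\beta |X(s_0)|^{p-2}X(s_0)\varphi(s_0)=\mu\int_0^{s_0}|X|^{p-2}X\varphi\,ds\qquad\text{for all }\varphi\in W^{1,p}(0,s_0), \] where functions in $W^{1,p}(0,s_0)$ are identified with their continuous representatives on $[0,s_0]$. Let $\pi_p=2\int_0^1(1-t^p)^{-1/p}dt$. Let $z:[0,\frac{\pi_p}2]\to[0,1]$ be the inverse of $\arccos_p(x)=\int_x^1(1-t^p)^{-1/p}dt$, and let $\cos_p$ be the even, $2\pi_p$-periodic function on $\mathbb R$ equal to $z(t)$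 on $[0,\frac{\pi_p}2]$ and to $-z(\pi_p-t)$ on $[\frac{\pi_p}2,\pi_p]$. Let $\cosh_p$ be the even function on $\mathbb R$ whose restriction to $[0,+\infty)$ is the inverse of $\operatorname{arccosh}_p(x)=\int_1^x(t^p-1)^{-1/p}dt$, $x\ge1$. **Theorem.** Problem (1) has a smallest eigenvalue $\mu_1=\mu_1(\beta,s_0)$, and \[ \mu_1(\beta,s_0)=\inf_{v}\frac{\int_0^{s_0}|v'(s)|^p\,ds+\beta |v(s_0)|^p}{\int_0^{s_0}|v(s)|^p\,ds}, \] where the infimum is over all $v\in W^{1,p}(0,s_0)\setminus\{0\}$ that have a one-sided derivative at $0$ with $|v'(0)|^{p-2}v'(0)=0$; the infimum over all $v\in W^{1,p}(0,s_0)\setminus\{0\}$ has the same value. The eigenfunctions corresponding to $\mu_1$ belong to $C^1([0,s_0])$ and satisfy (1) pointwise, are unique up to a multiplicative constant, and have constant sign (they do not vanish on $[0,s_0]$). The eigenvalue $\mu_1$ has the sign of $\beta$: it is positive, zero or negative according to whether $\beta$ is. If $\beta>0$, then \[ X(s)=\cos_p\left(\left(\tfrac{\mu_1}{p-1}\right)^{1/p}s\right)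 \] is an eigenfunction for $\mu_1$, and $\mu_1$ is the smallest $\mu>0$ that satisfies \[ \frac{\mu}{p-1}=\frac{\beta^{p'}}{\cos_p^{-p}\left(\left(\frac{\mu}{p-1}\right)^{1/p}s_0\right)-1}. \] If $\beta<0$, then \[ X(s)=\cosh_p\left(\left(\tfrac{-\mu_1}{p-1}\right)^{1/p}s\right) \] is an eigenfunction for $\mu_1$, and $\mu_1$ is the unique $\mu<0$ that satisfies \[ -\frac{\mu}{p-1}=\frac{|\beta|^{p'}}{1-\cosh_p^{-p}\left(\left(\frac{-\mu}{p-1}\right)^{1/p}s_0\right)}. \] -/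

import Mathlib

open Set MeasureTheory
open scoped ContDiff ENNReal

noncomputable section

namespace RobinPLap

/-- The odd power `|x|^{p-2} x` (it vanishes at `x = 0`). -/
def oddPow (p x : ℝ) : ℝ := |x| ^ (p - 2) * x

/-- `g` is a weak (distributional) derivative of `v` on `(0, s₀)`. -/
def HasWeakDeriv (s₀ : ℝ) (v g : ℝ → ℝ) : Prop :=
  ∀ φ : ℝ → ℝ, ContDiff ℝ ∞ φ → HasCompactSupport φ → tsupport φ ⊆ Ioo 0 s₀ →
    ∫ s in Ioo 0 s₀, v s * deriv φ s = - ∫ s in Ioo 0 s₀, g s * φ s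

/-- `v` belongs to `W^{1,p}(0, s₀)` and `g` is its weak derivative. As `v(s₀)` is a boundary value,
an element of the Sobolev space is given by its representative that is continuous on `[0, s₀]`.
The values of `v` and `g` outside `[0, s₀]` play no role. -/
structure IsSobolev (p s₀ : ℝ) (v g : ℝ → ℝ) : Prop where
  continuousOn : ContinuousOn v (Icc 0 s₀)
  memLp : MemLp v (ENNReal.ofReal p) (volume.restrict (Ioo 0 s₀))
  memLp_deriv : MemLp g (ENNReal.ofReal p) (volume.restrict (Ioo 0 s₀))
  hasWeakDeriv : HasWeakDeriv s₀ v g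

/-- `X ∈ W^{1,p}(0, s₀)` is a weak solution of `(|X'|^{p-2} X')' + μ |X|^{p-2} X = 0` in `(0, s₀)`
with the Neumann condition at `0` and the Robin condition
`|X'(s₀)|^{p-2} X'(s₀) + β |X(s₀)|^{p-2} X(s₀) = 0` at `s₀`. -/
def IsWeakSolution (p β s₀ μ : ℝ) (X : ℝ → ℝ) : Prop :=
  ∃ X' : ℝ → ℝ, IsSobolev p s₀ X X' ∧
    ∀ φ φ' : ℝ → ℝ, IsSobolev p s₀ φ φ' →
      (∫ s in Ioo 0 s₀, oddPow p (X' s) * φ' s) + β * oddPow p (X s₀) * φ s₀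
        = μ * ∫ s in Ioo 0 s₀, oddPow p (X s) * φ s

/-- `X` is a classical solution of the same problem: `X ∈ C¹([0, s₀])`, the flux `|X'|^{p-2} X'`
is differentiable in `(0, s₀)`, and the equation and the boundary conditions hold pointwise. -/
def IsClassicalSolution (p β s₀ μ : ℝ) (X : ℝ → ℝ) : Prop :=
  ∃ X' : ℝ → ℝ, ContinuousOn X' (Icc 0 s₀) ∧
    (∀ s ∈ Icc 0 s₀, HasDerivWithinAt X (X' s) (Icc 0 s₀) s) ∧
    (∀ s ∈ Ioo 0 s₀, ∃ d : ℝ, HasDerivAt (fun t => oddPow p (X' t)) d s ∧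
      d + μ * oddPow p (X s) = 0) ∧
    oddPow p (X' 0) = 0 ∧
    oddPow p (X' s₀) + β * oddPow p (X s₀) = 0

/-- An eigenfunction for `μ`: a nontrivial solution. -/
def IsEigenfunction (p β s₀ μ : ℝ) (X : ℝ → ℝ) : Prop :=
  IsWeakSolution p β s₀ μ X ∧ ∃ s ∈ Icc 0 s₀, X s ≠ 0

def IsEigenvalue (p β s₀ μ : ℝ) : Prop :=
  ∃ X : ℝ → ℝ, IsEigenfunction p β s₀ μ X

/-- The Rayleigh quotient of `v`, with weak derivative `g`. -/
def rayleigh (p β s₀ : ℝ) (v g : ℝ → ℝ) : ℝ :=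
  ((∫ s in Ioo 0 s₀, |g s| ^ p) + β * |v s₀| ^ p) / ∫ s in Ioo 0 s₀, |v s| ^ p

/-- The values of the Rayleigh quotient on `W^{1,p}(0, s₀) \ {0}`. -/
def rayleighValues (p β s₀ : ℝ) : Set ℝ :=
  {r | ∃ v g : ℝ → ℝ, IsSobolev p s₀ v g ∧ (∃ s ∈ Icc 0 s₀, v s ≠ 0) ∧ r = rayleigh p β s₀ v g}

/-- The values of the Rayleigh quotient on those `v ∈ W^{1,p}(0, s₀) \ {0}` that have a one-sided
derivative `d` at `0` with `|d|^{p-2} d = 0`. -/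
def neumannRayleighValues (p β s₀ : ℝ) : Set ℝ :=
  {r | ∃ v g : ℝ → ℝ, IsSobolev p s₀ v g ∧ (∃ s ∈ Icc 0 s₀, v s ≠ 0) ∧
    (∃ d : ℝ, HasDerivWithinAt v d (Icc 0 s₀) 0 ∧ oddPow p d = 0) ∧ r = rayleigh p β s₀ v g}

/-- `arccos_p : [0, 1] → ℝ`. -/
def arccosP (p x : ℝ) : ℝ := ∫ t in x..1, 1 / (1 - t ^ p) ^ (1 / p)

/-- `π_p = 2 ∫₀¹ (1 - t^p)^{-1/p} dt`. -/
def piP (p : ℝ) : ℝ := 2 * ∫ t in (0 : ℝ)..1, 1 / (1 - t ^ p) ^ (1 / p)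

/-- The inverse `z : [0, π_p / 2] → [0, 1]` of `arccos_p`. -/
def cosPBranch (p t : ℝ) : ℝ := Function.invFunOn (arccosP p) (Icc 0 1) t

/-- `cos_p`: the even `2 π_p`-periodic function equal to `z(t)` on `[0, π_p / 2]` and to
`-z(π_p - t)` on `[π_p / 2, π_p]`; here `r ∈ [0, π_p]` is the distance of `t` to `2 π_p ℤ`. -/
def cosP (p t : ℝ) : ℝ :=
  let r : ℝ := |t - 2 * piP p * round (t / (2 * piP p))|
  if r ≤ piP p / 2 then cosPBranch p r else - cosPBranch p (piP p - r)

/-- `arccosh_p : [1, ∞) → [0, ∞)`. -/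
def arccoshP (p x : ℝ) : ℝ := ∫ t in (1 : ℝ)..x, 1 / (t ^ p - 1) ^ (1 / p)

/-- `cosh_p`: the even function whose restriction to `[0, ∞)` is the inverse of `arccosh_p`. -/
def coshP (p t : ℝ) : ℝ := Function.invFunOn (arccoshP p) (Ici 1) |t|

/-- The equation `μ/(p-1) = β^{p'} / (cos_p^{-p}((μ/(p-1))^{1/p} s₀) - 1)`, `p' = p/(p-1)`. -/
def CosEquation (p β s₀ μ : ℝ) : Prop :=
  μ / (p - 1) = β ^ (p / (p - 1)) / (cosP p ((μ / (p - 1)) ^ (1 / p) * s₀) ^ (-p) - 1)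

/-- The equation `-μ/(p-1) = |β|^{p'} / (1 - cosh_p^{-p}((-μ/(p-1))^{1/p} s₀))`, `p' = p/(p-1)`. -/
def CoshEquation (p β s₀ μ : ℝ) : Prop :=
  -μ / (p - 1) = |β| ^ (p / (p - 1)) / (1 - coshP p ((-μ / (p - 1)) ^ (1 / p) * s₀) ^ (-p))

end RobinPLap

end

open RobinPLap

namespace RobinPLap

open Filter Topology intervalIntegral

/-! ### Absolutely continuous functions on `[0, s]` -/

/-! The whole theorem follows from the existence of one positive classical solution `X` for some
`μ`; no compactness or direct method is needed. For `v ∈ W^{1,p}` put `u = v / X`. Differentiating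
`|X'|^{p-2} X' X |u|^p` and integrating over `[0, s]` gives Picone's identity: `∫ |v'|^p + β
|v(s)|^p - μ ∫ |v|^p = ∫ R`, where `R ≥ 0` is the gap at `v'` between `|·|^p` and its tangent at `X'
u`. Hence `μ` bounds every Rayleigh quotient from below (`IsClassicalSolution.le_rayleigh`). An
eigenfunction tested against itself has its eigenvalue as quotient, so `μ` is the least eigenvalue
and both infima are attained at `X`. If the quotient equals `μ`, strict convexity gives `v' = X' u`
a.e., so `u' = 0` and `v = c X`: simplicity, constant sign and regularity come together
(`IsClassicalSolution.eigenfunction_eq_const_mul`).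

The solution `X` is explicit. The profiles satisfy `|C'|^p = ε (1 - C^p)`, with `ε = 1` for `cos_p`
and `ε = -1` for `cosh_p`, so `C(k x)` solves the equation with `μ = ε (p-1) k^p`, and the Robin
condition becomes the characteristic equation in `k` (`isClassicalSolution_of_profile`). That
equation is solved by the intermediate value theorem and monotonicity; for `β = 0`, constants work.

Weak derivatives are handled by passing to absolutely continuous functions (`IsSobolev.hasACDeriv`),
for which the product rule, the chain rule and the fundamental theorem of calculus hold. -/

theorem AbsolutelyContinuousOnInterval.congr {f g : ℝ → ℝ} {a b : ℝ}
    (hf : AbsolutelyContinuousOnInterval f a b) (h : EqOn f g (uIcc a b)) :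
    AbsolutelyContinuousOnInterval g a b := by
  rw [absolutelyContinuousOnInterval_iff] at hf ⊢
  intro ε hε
  obtain ⟨δ, hδ, H⟩ := hf ε hε
  refine ⟨δ, hδ, fun E hE hl => ?_⟩
  refine lt_of_eq_of_lt (Finset.sum_congr rfl fun i hi => ?_) (H E hE hl)
  rw [h (hE.1 i hi).1, h (hE.1 i hi).2]

/-- An absolutely continuous `f` has bounded range on the interval, and a `C¹` function is Lipschitz
on bounded intervals. Needed for `Φ = |·|^p`, which is not globally Lipschitz. -/
theorem AbsolutelyContinuousOnInterval.comp_contDiff {f : ℝ → ℝ} {a b : ℝ}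
    (hf : AbsolutelyContinuousOnInterval f a b) {Φ : ℝ → ℝ} (hΦ : ContDiff ℝ 1 Φ) :
    AbsolutelyContinuousOnInterval (fun x => Φ (f x)) a b := by
  obtain ⟨C, hC⟩ := hf.exists_bound
  obtain ⟨K, hK⟩ := (hΦ.contDiffOn (s := Icc (-C) C)).exists_lipschitzOnWith one_ne_zero
    (convex_Icc _ _) isCompact_Icc
  have hmem : ∀ x ∈ uIcc a b, f x ∈ Icc (-C) C := fun x hx => abs_le.1 (hC x hx)
  rw [absolutelyContinuousOnInterval_iff] at hf ⊢
  intro ε hε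
  -- `K + 1` rather than `K`, since the Lipschitz constant may be zero.
  obtain ⟨δ, hδ, H⟩ := hf (ε / (K + 1)) (by positivity)
  refine ⟨δ, hδ, fun E hE hl => ?_⟩
  have h1 := H E hE hl
  have h2 : ∑ i ∈ Finset.range E.1, dist (Φ (f (E.2 i).1)) (Φ (f (E.2 i).2))
      ≤ K * ∑ i ∈ Finset.range E.1, dist (f (E.2 i).1) (f (E.2 i).2) := by
    rw [Finset.mul_sum]
    exact Finset.sum_le_sum fun i hi =>
      hK.dist_le_mul _ (hmem _ (hE.1 i hi).1) _ (hmem _ (hE.1 i hi).2)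
  have h3 : 0 ≤ ∑ i ∈ Finset.range E.1, dist (f (E.2 i).1) (f (E.2 i).2) :=
    Finset.sum_nonneg fun _ _ => dist_nonneg
  rw [lt_div_iff₀ (by positivity)] at h1
  nlinarith

/-- `v` is absolutely continuous on `[0, s]` with almost everywhere derivative `g`. -/
structure HasACDeriv (s : ℝ) (v g : ℝ → ℝ) : Prop where
  ac : AbsolutelyContinuousOnInterval v 0 s
  ae_hasDerivAt : ∀ᵐ x ∂volume.restrict (Ioo 0 s), HasDerivAt v (g x) x

namespace HasACDeriv

variable {s : ℝ} {u v f g : ℝ → ℝ}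

theorem continuousOn (hs : 0 < s) (hv : HasACDeriv s v g) : ContinuousOn v (Icc 0 s) := by
  simpa [uIcc_of_le hs.le] using hv.ac.continuousOn

theorem ae_deriv_eq (hv : HasACDeriv s v g) : ∀ᵐ x ∂volume.restrict (Ioo 0 s), deriv v x = g x :=
  hv.ae_hasDerivAt.mono fun _ hx => hx.deriv

theorem integrableOn (hs : 0 < s) (hv : HasACDeriv s v g) : IntegrableOn g (Ioo 0 s) := by
  have h := hv.ac.intervalIntegrable_deriv
  rw [intervalIntegrable_iff_integrableOn_Ioo_of_le hs.le] at h
  exact h.congr hv.ae_deriv_eq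

theorem integral_eq (hs : 0 < s) (hv : HasACDeriv s v g) :
    ∫ x in Ioo 0 s, g x = v s - v 0 := by
  rw [← hv.ac.integral_deriv_eq_sub, integral_of_le hs.le, integral_Ioc_eq_integral_Ioo]
  exact (integral_congr_ae hv.ae_deriv_eq).symm

theorem mul (hu : HasACDeriv s u f) (hv : HasACDeriv s v g) :
    HasACDeriv s (fun x => u x * v x) (fun x => f x * v x + u x * g x) where
  ac := hu.ac.mul hv.ac
  ae_hasDerivAt := by
    filter_upwards [hu.ae_hasDerivAt, hv.ae_hasDerivAt] with x h1 h2 using h1.mul h2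

theorem add (hu : HasACDeriv s u f) (hv : HasACDeriv s v g) :
    HasACDeriv s (fun x => u x + v x) (fun x => f x + g x) where
  ac := hu.ac.add hv.ac
  ae_hasDerivAt := by
    filter_upwards [hu.ae_hasDerivAt, hv.ae_hasDerivAt] with x h1 h2 using h1.add h2

theorem comp (hv : HasACDeriv s v g) {Φ Φ' : ℝ → ℝ} (hΦ : ContDiff ℝ 1 Φ)
    (hΦ' : ∀ x, HasDerivAt Φ (Φ' x) x) :
    HasACDeriv s (fun x => Φ (v x)) (fun x => Φ' (v x) * g x) where
  ac := AbsolutelyContinuousOnInterval.comp_contDiff hv.ac hΦ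
  ae_hasDerivAt := by
    filter_upwards [hv.ae_hasDerivAt] with x h using (hΦ' (v x)).comp x h

theorem congr (hs : 0 < s) (hv : HasACDeriv s v g) (h : EqOn v u (Icc 0 s)) :
    HasACDeriv s u g where
  ac := AbsolutelyContinuousOnInterval.congr hv.ac (by rwa [uIcc_of_le hs.le])
  ae_hasDerivAt := by
    filter_upwards [hv.ae_hasDerivAt, ae_restrict_mem measurableSet_Ioo] with x h1 hx
    refine h1.congr_of_eventuallyEq ?_
    filter_upwards [Ioo_mem_nhds hx.1 hx.2] with y hy
    exact (h ⟨hy.1.le, hy.2.le⟩).symm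

theorem congr_deriv (hv : HasACDeriv s v f) (h : f =ᵐ[volume.restrict (Ioo 0 s)] g) :
    HasACDeriv s v g where
  ac := hv.ac
  ae_hasDerivAt := by filter_upwards [hv.ae_hasDerivAt, h] with x h1 h2 using h2 ▸ h1

theorem integral (hs : 0 < s) (hg : IntegrableOn g (Ioo 0 s)) :
    HasACDeriv s (fun x => ∫ t in (0 : ℝ)..x, g t) g := by
  rw [← intervalIntegrable_iff_integrableOn_Ioo_of_le hs.le] at hg
  refine ⟨hg.absolutelyContinuousOnInterval_intervalIntegral left_mem_uIcc, ?_⟩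
  filter_upwards [ae_restrict_of_ae hg.ae_hasDerivAt_integral,
    ae_restrict_mem measurableSet_Ioo] with x h1 hx
  exact h1 (by rw [uIcc_of_le hs.le]; exact ⟨hx.1.le, hx.2.le⟩) 0 left_mem_uIcc

theorem const (c : ℝ) : HasACDeriv s (fun _ => c) (fun _ => 0) where
  ac := (LipschitzWith.const c).lipschitzOnWith.absolutelyContinuousOnInterval
  ae_hasDerivAt := .of_forall fun x => hasDerivAt_const x c

theorem of_hasDerivAt (hs : 0 < s) (hv : ContinuousOn v (Icc 0 s)) (hg : ContinuousOn g (Icc 0 s))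
    (h : ∀ x ∈ Ioo 0 s, HasDerivAt v (g x) x) : HasACDeriv s v g := by
  have hi : IntegrableOn g (Ioo 0 s) := hg.integrableOn_Icc.mono_set Ioo_subset_Icc_self
  refine ((const (v 0)).add (HasACDeriv.integral hs hi)).congr hs (fun x hx => ?_)
    |>.congr_deriv (by simp)
  have hsub : Icc 0 x ⊆ Icc 0 s := Icc_subset_Icc_right hx.2
  have := integral_eq_sub_of_hasDerivAt_of_le hx.1 (hv.mono hsub)
    (fun y hy => h y ⟨hy.1, hy.2.trans_le hx.2⟩)
    ((hg.mono hsub).intervalIntegrable_of_Icc hx.1)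
  simp only [this]; ring

theorem eqOn_const (hs : 0 < s) (hv : HasACDeriv s v g)
    (h : ∀ᵐ x ∂volume.restrict (Ioo 0 s), g x = 0) : ∀ x ∈ Icc 0 s, v x = v 0 := by
  have key : ∀ᵐ x, x ∈ uIcc 0 s → HasDerivAt v 0 x := by
    have h1 : ∀ᵐ x, x ∈ Icc 0 s → HasDerivAt v 0 x := by
      rw [← ae_restrict_iff' measurableSet_Icc, ← restrict_Ioo_eq_restrict_Icc]
      filter_upwards [h, hv.ae_hasDerivAt] with x h1 h2 using h1 ▸ h2
    rwa [uIcc_of_le hs.le]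
  obtain ⟨C, hC⟩ := hv.ac.const_of_ae_hasDerivAt_zero key
  rw [uIcc_of_le hs.le] at hC
  intro x hx
  rw [hC x hx, hC 0 ⟨le_rfl, hs.le⟩]

end HasACDeriv

/-! ### The fundamental lemma for weak derivatives on an interval -/

theorem exists_Icc_of_isCompact_subset_Ioo {s : ℝ} (hs : 0 < s) {K : Set ℝ} (hK : IsCompact K)
    (hKs : K ⊆ Ioo 0 s) : ∃ a b, 0 < a ∧ a ≤ b ∧ b < s ∧ K ⊆ Icc a b := by
  -- The midpoint is added so that the set is nonempty even when `K = ∅`.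
  have hK' : IsCompact (insert (s / 2) K) := hK.insert _
  have hsub : insert (s / 2) K ⊆ Ioo 0 s :=
    insert_subset ⟨by linarith, by linarith⟩ hKs
  obtain ⟨a, ha, ha'⟩ := hK'.exists_isLeast (insert_nonempty _ _)
  obtain ⟨b, hb, hb'⟩ := hK'.exists_isGreatest (insert_nonempty _ _)
  exact ⟨a, b, (hsub ha).1, ha' hb, (hsub hb).2,
    fun x hx => ⟨ha' (mem_insert_of_mem _ hx), hb' (mem_insert_of_mem _ hx)⟩⟩

/-- The primitive from `0` vanishes to the left of the support of `χ` trivially, and to its right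
because `χ` has mean zero. -/
theorem exists_test_primitive {s : ℝ} (hs : 0 < s) {χ : ℝ → ℝ} (hχ : ContDiff ℝ ∞ χ)
    (hc : HasCompactSupport χ) (hsupp : tsupport χ ⊆ Ioo 0 s) (hint : ∫ x in Ioo 0 s, χ x = 0) :
    ∃ φ : ℝ → ℝ, ContDiff ℝ ∞ φ ∧ HasCompactSupport φ ∧ tsupport φ ⊆ Ioo 0 s ∧
      deriv φ = χ := by
  obtain ⟨a, b, ha, hab, hb, hK⟩ := exists_Icc_of_isCompact_subset_Ioo hs hc hsupp
  have hz : ∀ x, x ∉ Icc a b → χ x = 0 := fun x hx =>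
    image_eq_zero_of_notMem_tsupport fun h => hx (hK h)
  have hd : ∀ x, HasDerivAt (fun x => ∫ t in (0 : ℝ)..x, χ t) (χ x) x := fun x =>
    integral_hasDerivAt_right (hχ.continuous.intervalIntegrable _ _)
      hχ.continuous.aestronglyMeasurable.stronglyMeasurableAtFilter hχ.continuous.continuousAt
  have hder : deriv (fun x => ∫ t in (0 : ℝ)..x, χ t) = χ := funext fun x => (hd x).deriv
  have hφz : ∀ x, x ∉ Icc a b → ∫ t in (0 : ℝ)..x, χ t = 0 := by
    intro x hx
    rcases lt_or_ge x a with h | h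
    · refine integral_zero_ae (.of_forall fun t ht => hz t fun ht' => ?_)
      rw [mem_uIoc] at ht
      rcases ht with ht | ht <;> linarith [ht.1, ht.2, ht'.1]
    · have hxb : b < x := by
        by_contra! hh
        exact hx ⟨h, hh⟩
      have h1 : ∫ t in (0 : ℝ)..s, χ t = 0 := by
        rw [integral_of_le hs.le, integral_Ioc_eq_integral_Ioo, hint]
      have h2 : ∫ t in s..x, χ t = 0 := by
        refine integral_zero_ae (.of_forall fun t ht => hz t fun ht' => ?_)
        rw [mem_uIoc] at ht
        rcases ht with ht | ht <;> linarith [ht.1, ht.2, ht'.2]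
      rw [← integral_add_adjacent_intervals (hχ.continuous.intervalIntegrable 0 s)
        (hχ.continuous.intervalIntegrable s x), h1, h2, add_zero]
  have hts : tsupport (fun x => ∫ t in (0 : ℝ)..x, χ t) ⊆ Icc a b :=
    closure_minimal (fun x hx => by_contra fun h => hx (hφz x h)) isClosed_Icc
  refine ⟨_, contDiff_infty_iff_deriv.2 ⟨fun x => (hd x).differentiableAt, by rwa [hder]⟩,
    HasCompactSupport.of_support_subset_isCompact isCompact_Icc (subset_closure.trans hts),
    hts.trans fun x hx => ⟨ha.trans_le hx.1, hx.2.trans_lt hb⟩, hder⟩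

/-- The **du Bois-Reymond lemma**. -/
theorem eqOn_const_of_integral_mul_deriv_eq_zero {s : ℝ} (hs : 0 < s) {u : ℝ → ℝ}
    (hu : ContinuousOn u (Icc 0 s))
    (h : ∀ φ : ℝ → ℝ, ContDiff ℝ ∞ φ → HasCompactSupport φ → tsupport φ ⊆ Ioo 0 s →
      ∫ x in Ioo 0 s, u x * deriv φ x = 0) :
    ∃ c, ∀ x ∈ Icc 0 s, u x = c := by
  let B : ContDiffBump (s / 2) := ⟨s / 8, s / 4, by linarith, by linarith⟩
  set η : ℝ → ℝ := B.normed volume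
  have hη : ContDiff ℝ ∞ η := B.contDiff_normed
  have hηc : HasCompactSupport η := B.hasCompactSupport_normed
  have hηs : tsupport η ⊆ Ioo 0 s := by
    rw [B.tsupport_normed_eq, Real.closedBall_eq_Icc]
    intro x hx
    have h1 : s / 2 - s / 4 ≤ x := hx.1
    have h2 : x ≤ s / 2 + s / 4 := hx.2
    exact ⟨by linarith, by linarith⟩
  have hηi : ∫ x in Ioo 0 s, η x = 1 := by
    rw [setIntegral_eq_integral_of_forall_compl_eq_zero fun x hx =>
      image_eq_zero_of_notMem_tsupport fun h' => hx (hηs h')]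
    exact B.integral_normed
  have hint : ∀ χ : ℝ → ℝ, ContDiff ℝ ∞ χ → IntegrableOn χ (Ioo 0 s) := fun χ hχ =>
    hχ.continuous.continuousOn.integrableOn_Icc.mono_set Ioo_subset_Icc_self
  have hinu : ∀ χ : ℝ → ℝ, ContDiff ℝ ∞ χ → IntegrableOn (fun x => u x * χ x) (Ioo 0 s) :=
    fun χ hχ => (hu.mul hχ.continuous.continuousOn).integrableOn_Icc.mono_set Ioo_subset_Icc_self
  have hui : IntegrableOn u (Ioo 0 s) := hu.integrableOn_Icc.mono_set Ioo_subset_Icc_self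
  set c := ∫ x in Ioo 0 s, u x * η x
  have hae : ∀ᵐ x, x ∈ Ioo 0 s → u x - c = 0 := by
    refine isOpen_Ioo.ae_eq_zero_of_integral_contDiff_smul_eq_zero
      (hui.sub (by simp)).locallyIntegrableOn fun ψ hψ hψc hψs => ?_
    -- Subtracting `m η`, where `η` has integral one, gives `ψ` mean zero, so `ψ - m η` is the
    -- derivative of a test function.
    set m := ∫ x in Ioo 0 s, ψ x
    have hχ : ContDiff ℝ ∞ (fun x => ψ x - m * η x) := hψ.sub (contDiff_const.mul hη)
    have hsub : tsupport (fun x => ψ x - m * η x) ⊆ tsupport ψ ∪ tsupport η :=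
      closure_minimal (fun x hx => by
        by_contra hcon
        rw [mem_union, not_or] at hcon
        apply hx
        simp [image_eq_zero_of_notMem_tsupport hcon.1, image_eq_zero_of_notMem_tsupport hcon.2])
        ((isClosed_tsupport _).union (isClosed_tsupport _))
    have hχc : HasCompactSupport (fun x => ψ x - m * η x) :=
      (hψc.isCompact.union hηc.isCompact).of_isClosed_subset (isClosed_tsupport _) hsub
    obtain ⟨φ, h1, h2, h3, h4⟩ := exists_test_primitive hs hχ hχc
      (hsub.trans (union_subset hψs hηs)) (by
        rw [integral_sub (hint _ hψ) ((hint _ hη).const_mul m), MeasureTheory.integral_const_mul,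
          hηi, mul_one, sub_self])
    have h5 := h φ h1 h2 h3
    rw [h4] at h5
    have h6 : ∫ x in Ioo 0 s, u x * (ψ x - m * η x)
        = (∫ x in Ioo 0 s, u x * ψ x) - m * c := by
      rw [← MeasureTheory.integral_const_mul, ← integral_sub (hinu _ hψ) ((hinu _ hη).const_mul m)]
      congr 1 with x
      ring
    rw [← setIntegral_eq_integral_of_forall_compl_eq_zero (s := Ioo 0 s) fun x hx => by
      rw [image_eq_zero_of_notMem_tsupport fun h' => hx (hψs h'), zero_smul]]
    have h7 : ∫ x in Ioo 0 s, ψ x • (u x - c)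
        = (∫ x in Ioo 0 s, u x * ψ x) - m * c := by
      rw [← MeasureTheory.integral_mul_const, ← integral_sub (hinu _ hψ) ((hint _ hψ).mul_const c)]
      congr 1 with x
      simp only [smul_eq_mul]
      ring
    rw [h7, ← h6, h5]
  refine ⟨c, Measure.eqOn_Icc_of_ae_eq volume hs.ne ?_ hu continuousOn_const⟩
  rw [← restrict_Ioo_eq_restrict_Icc]
  refine (ae_restrict_iff' measurableSet_Ioo).2 (hae.mono fun x hx hxs => sub_eq_zero.1 (hx hxs))

theorem memLp_of_continuousOn {s : ℝ} {g : ℝ → ℝ} {q : ℝ≥0∞} (hg : ContinuousOn g (Icc 0 s)) :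
    MemLp g q (volume.restrict (Ioo 0 s)) := by
  obtain ⟨C, hC⟩ := isCompact_Icc.exists_bound_of_continuousOn hg
  refine MemLp.of_bound
    ((hg.mono Ioo_subset_Icc_self).aestronglyMeasurable measurableSet_Ioo) C ?_
  filter_upwards [ae_restrict_mem measurableSet_Ioo] with x hx
  exact hC x ⟨hx.1.le, hx.2.le⟩

theorem integrableOn_Ioo_of_continuousOn {s : ℝ} {g : ℝ → ℝ} (hg : ContinuousOn g (Icc 0 s)) :
    IntegrableOn g (Ioo 0 s) :=
  hg.integrableOn_Icc.mono_set Ioo_subset_Icc_self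

/-- Integration by parts: `v φ` is absolutely continuous and vanishes at both endpoints. -/
theorem HasACDeriv.hasWeakDeriv {s : ℝ} (hs : 0 < s) {v g : ℝ → ℝ} (hv : HasACDeriv s v g) :
    HasWeakDeriv s v g := by
  intro φ hφ hc hsupp
  have hφd : HasACDeriv s φ (deriv φ) := HasACDeriv.of_hasDerivAt hs hφ.continuous.continuousOn
    (hφ.continuous_deriv (by simp)).continuousOn
    fun x _ => (hφ.differentiable (by simp) x).hasDerivAt
  have h0 : φ 0 = 0 := image_eq_zero_of_notMem_tsupport fun h => lt_irrefl _ (hsupp h).1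
  have h1 : φ s = 0 := image_eq_zero_of_notMem_tsupport fun h => lt_irrefl _ (hsupp h).2
  have hp := (hv.mul hφd).integral_eq hs
  have hi1 : IntegrableOn (fun x => v x * deriv φ x) (Ioo 0 s) :=
    ((hv.continuousOn hs).mul (hφ.continuous_deriv (by simp)).continuousOn).integrableOn_Icc.mono_set
      Ioo_subset_Icc_self
  have hi2 : IntegrableOn (fun x => g x * φ x) (Ioo 0 s) := by
    refine (((hv.mul hφd).integrableOn hs).sub hi1).congr (.of_forall fun x => ?_)
    simp
  rw [integral_add hi2 hi1, h0, h1] at hp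
  linarith

theorem HasACDeriv.isSobolev {p s : ℝ} (hs : 0 < s) {v g : ℝ → ℝ}
    (hv : HasACDeriv s v g)
    (hg : MemLp g (ENNReal.ofReal p) (volume.restrict (Ioo 0 s))) : IsSobolev p s v g where
  continuousOn := hv.continuousOn hs
  memLp := memLp_of_continuousOn (hv.continuousOn hs)
  memLp_deriv := hg
  hasWeakDeriv := hv.hasWeakDeriv hs

/-- `v` minus the primitive of `g` is continuous with zero weak derivative, hence constant by du
Bois-Reymond; `p > 1` on a bounded interval makes `g` integrable. -/
theorem IsSobolev.hasACDeriv {p s : ℝ} (hp : 1 < p) (hs : 0 < s) {v g : ℝ → ℝ}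
    (hv : IsSobolev p s v g) : HasACDeriv s v g := by
  have hg : IntegrableOn g (Ioo 0 s) :=
    hv.memLp_deriv.integrable (by simpa using ENNReal.ofReal_le_ofReal hp.le)
  have hw := HasACDeriv.integral hs hg
  obtain ⟨c, hc⟩ := eqOn_const_of_integral_mul_deriv_eq_zero hs
    (hv.continuousOn.sub (hw.continuousOn hs)) fun φ h1 h2 h3 => by
      have e1 := hv.hasWeakDeriv φ h1 h2 h3
      have e2 := hw.hasWeakDeriv hs φ h1 h2 h3
      have hd := (h1.continuous_deriv (by simp)).continuousOn (s := Icc 0 s)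
      have i1 := (hv.continuousOn.mul hd).integrableOn_Icc (μ := volume)
        |>.mono_set Ioo_subset_Icc_self
      have i2 := ((hw.continuousOn hs).mul hd).integrableOn_Icc (μ := volume)
        |>.mono_set Ioo_subset_Icc_self
      simp only [Pi.sub_apply, sub_mul]
      exact (integral_sub i1 i2).trans (sub_eq_zero.2 (e1.trans e2.symm))
  refine ((HasACDeriv.const c).add hw).congr hs (fun x hx => ?_) |>.congr_deriv (by simp)
  have h : v x - ∫ t in (0 : ℝ)..x, g t = c := hc x hx
  simp only [← h, sub_add_cancel]

/-! ### The odd power -/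

section OddPow

variable {p : ℝ}

theorem oddPow_zero (p : ℝ) : oddPow p 0 = 0 := by simp [oddPow]

theorem oddPow_neg (p x : ℝ) : oddPow p (-x) = -oddPow p x := by simp [oddPow]

theorem oddPow_mul (p x y : ℝ) : oddPow p (x * y) = oddPow p x * oddPow p y := by
  rw [oddPow, abs_mul, Real.mul_rpow (abs_nonneg _) (abs_nonneg _), oddPow, oddPow]
  ring

theorem oddPow_of_nonneg (hp : 1 < p) {x : ℝ} (hx : 0 ≤ x) : oddPow p x = x ^ (p - 1) := by
  rcases hx.eq_or_lt with rfl | hx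
  · rw [oddPow_zero, Real.zero_rpow (by linarith)]
  · rw [oddPow, abs_of_pos hx, ← Real.rpow_add_one hx.ne']
    congr 1
    ring

theorem oddPow_mul_self (hp : 1 < p) (x : ℝ) : oddPow p x * x = |x| ^ p := by
  rcases eq_or_ne x 0 with rfl | hx
  · rw [mul_zero, abs_zero, Real.zero_rpow (by linarith)]
  · rw [oddPow, mul_assoc, ← abs_mul_abs_self x, ← mul_assoc,
      ← Real.rpow_add_one (abs_pos.2 hx).ne', ← Real.rpow_add_one (abs_pos.2 hx).ne']
    congr 1
    ring

theorem abs_mul_rpow (p x y : ℝ) : |x * y| ^ p = |x| ^ p * |y| ^ p := by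
  rw [abs_mul, Real.mul_rpow (abs_nonneg _) (abs_nonneg _)]

theorem hasDerivAt_abs_rpow_oddPow (hp : 1 < p) (x : ℝ) :
    HasDerivAt (fun y : ℝ => |y| ^ p) (p * oddPow p x) x := by
  have := hasDerivAt_abs_rpow x hp
  rwa [mul_assoc] at this

theorem contDiff_abs_rpow (hp : 1 < p) : ContDiff ℝ 1 fun y : ℝ => |y| ^ p :=
  contDiff_norm_rpow (E := ℝ) hp

/-- Read off from the `C¹` function `|·|^p`, of which this is the derivative up to the factor `p`;
for `p < 2` the factor `|x|^{p-2}` is singular at `0`. -/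
theorem continuous_oddPow (hp : 1 < p) : Continuous (oddPow p) := by
  have h := (contDiff_abs_rpow hp).continuous_deriv le_rfl
  have h2 : (deriv fun y : ℝ => |y| ^ p) = fun x => p * oddPow p x :=
    funext fun x => (hasDerivAt_abs_rpow_oddPow hp x).deriv
  rw [h2] at h
  refine (continuous_const (y := p⁻¹) |>.mul h).congr fun x => ?_
  exact inv_mul_cancel_left₀ (by linarith) (oddPow p x)

theorem strictMono_oddPow (hp : 1 < p) : StrictMono (oddPow p) := by
  refine strictMono_of_odd_strictMonoOn_nonneg (oddPow_neg p) fun x hx y hy hxy => ?_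
  rw [oddPow_of_nonneg hp hx, oddPow_of_nonneg hp hy]
  exact Real.rpow_lt_rpow hx hxy (by linarith)

theorem oddPow_eq_zero (hp : 1 < p) {x : ℝ} : oddPow p x = 0 ↔ x = 0 := by
  conv_lhs => rw [← oddPow_zero p]
  exact (strictMono_oddPow hp).injective.eq_iff

/-- Strict convexity of `|·|^p`, in tangent form. -/
theorem abs_rpow_tangent_lt (hp : 1 < p) {x y : ℝ} (hxy : x ≠ y) :
    |x| ^ p + p * oddPow p x * (y - x) < |y| ^ p := by
  have hconv : StrictConvexOn ℝ univ fun y : ℝ => |y| ^ p := by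
    refine StrictMono.strictConvexOn_univ_of_deriv (contDiff_abs_rpow hp).continuous ?_
    have h2 : (deriv fun y : ℝ => |y| ^ p) = fun x => p * oddPow p x :=
      funext fun x => (hasDerivAt_abs_rpow_oddPow hp x).deriv
    rw [h2]
    exact (strictMono_oddPow hp).const_mul (by linarith)
  rcases hxy.lt_or_gt with h | h
  · have := hconv.lt_slope_of_hasDerivAt (mem_univ x) (mem_univ y) h
      (hasDerivAt_abs_rpow_oddPow hp x)
    rw [slope_def_field, lt_div_iff₀ (by linarith)] at this
    linarith
  · have := hconv.slope_lt_of_hasDerivAt (mem_univ y) (mem_univ x) h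
      (hasDerivAt_abs_rpow_oddPow hp x)
    rw [slope_def_field, div_lt_iff₀ (by linarith)] at this
    linarith

end OddPow

/-! ### Classical solutions -/

section Classical

variable {p β s μ : ℝ} {X : ℝ → ℝ}

theorem IsClassicalSolution.const_mul (hX : IsClassicalSolution p β s μ X) (c : ℝ) :
    IsClassicalSolution p β s μ fun x => c * X x := by
  obtain ⟨D, hD, hd, hF, h0, h1⟩ := hX
  refine ⟨fun x => c * D x, hD.const_mul c, fun x hx => (hd x hx).const_mul c, fun x hx => ?_, ?_,
    ?_⟩
  · obtain ⟨d, hd, he⟩ := hF x hx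
    refine ⟨oddPow p c * d, ?_, ?_⟩
    · simp only [oddPow_mul]
      exact hd.const_mul _
    · rw [oddPow_mul, ← mul_zero (oddPow p c), ← he]
      ring
  · rw [oddPow_mul, h0, mul_zero]
  · rw [oddPow_mul, oddPow_mul, ← mul_zero (oddPow p c), ← h1]
    ring

theorem IsClassicalSolution.congr (hX : IsClassicalSolution p β s μ X) (hs : 0 < s) {Y : ℝ → ℝ}
    (h : EqOn Y X (Icc 0 s)) : IsClassicalSolution p β s μ Y := by
  obtain ⟨D, hD, hd, hF, h0, h1⟩ := hX
  refine ⟨D, hD, fun x hx => (hd x hx).congr h (h hx), fun x hx => ?_, h0, ?_⟩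
  · rw [h ⟨hx.1.le, hx.2.le⟩]
    exact hF x hx
  · rw [h ⟨hs.le, le_rfl⟩]
    exact h1

/-- The form used for integration by parts: `X` and its flux are both absolutely continuous. The
Neumann condition forces `X'(0) = 0`, as the oddPow is injective. -/
theorem IsClassicalSolution.exists_hasACDeriv (hp : 1 < p) (hs : 0 < s)
    (hX : IsClassicalSolution p β s μ X) :
    ∃ D : ℝ → ℝ, ContinuousOn D (Icc 0 s) ∧ (∀ x ∈ Ioo 0 s, HasDerivAt X (D x) x) ∧
      HasDerivWithinAt X 0 (Icc 0 s) 0 ∧ HasACDeriv s X D ∧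
      HasACDeriv s (fun x => oddPow p (D x)) (fun x => -μ * oddPow p (X x)) ∧
      oddPow p (D 0) = 0 ∧ oddPow p (D s) = -β * oddPow p (X s) := by
  obtain ⟨D, hD, hd, hF, h0, h1⟩ := hX
  have hXc : ContinuousOn X (Icc 0 s) := fun x hx => (hd x hx).continuousWithinAt
  have hd' : ∀ x ∈ Ioo 0 s, HasDerivAt X (D x) x := fun x hx =>
    (hd x ⟨hx.1.le, hx.2.le⟩).hasDerivAt (Icc_mem_nhds hx.1 hx.2)
  refine ⟨D, hD, hd', ?_, HasACDeriv.of_hasDerivAt hs hXc hD hd', ?_, h0, by linarith⟩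
  · have := hd 0 ⟨le_rfl, hs.le⟩
    rwa [(oddPow_eq_zero hp).1 h0] at this
  · refine HasACDeriv.of_hasDerivAt hs ((continuous_oddPow hp).comp_continuousOn hD)
      (((continuous_oddPow hp).comp_continuousOn hXc).const_mul _) fun x hx => ?_
    obtain ⟨d, hd, he⟩ := hF x hx
    have : d = -μ * oddPow p (X x) := by linarith
    exact this ▸ hd

theorem IsClassicalSolution.isWeakSolution (hp : 1 < p) (hs : 0 < s)
    (hX : IsClassicalSolution p β s μ X) : IsWeakSolution p β s μ X := by
  obtain ⟨D, hD, -, -, hXD, hF, h0, h1⟩ := hX.exists_hasACDeriv hp hs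
  refine ⟨D, hXD.isSobolev hs (memLp_of_continuousOn hD), fun φ φ' hφ => ?_⟩
  have hm := hF.mul (hφ.hasACDeriv hp hs)
  have hi1 : IntegrableOn (fun x => -μ * oddPow p (X x) * φ x) (Ioo 0 s) :=
    integrableOn_Ioo_of_continuousOn ((((continuous_oddPow hp).comp_continuousOn
      (hXD.continuousOn hs)).const_mul _).mul hφ.continuousOn)
  -- Obtained by difference from the integrable derivative of flux times `φ`, so Hölder's inequality
  -- is not needed.
  have hi2 : IntegrableOn (fun x => oddPow p (D x) * φ' x) (Ioo 0 s) := by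
    refine ((hm.integrableOn hs).sub hi1).congr (.of_forall fun x => ?_)
    simp
  have h := hm.integral_eq hs
  rw [integral_add hi1 hi2, h0, h1] at h
  simp only [mul_assoc, MeasureTheory.integral_const_mul] at h
  linarith

end Classical

/-! ### Picone's identity -/

theorem IsSobolev.integrable_abs_deriv_rpow {p s : ℝ} (hp : 1 < p) {v g : ℝ → ℝ}
    (hv : IsSobolev p s v g) : IntegrableOn (fun x => |g x| ^ p) (Ioo 0 s) := by
  have := hv.memLp_deriv.integrable_norm_rpow (by simp; linarith) (by simp)
  rwa [ENNReal.toReal_ofReal (by linarith)] at this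

theorem IsSobolev.integral_abs_rpow_pos {p s : ℝ} (hp : 1 < p) (hs : 0 < s) {v g : ℝ → ℝ}
    (hv : IsSobolev p s v g) (hne : ∃ x ∈ Icc 0 s, v x ≠ 0) :
    0 < ∫ x in Ioo 0 s, |v x| ^ p := by
  have hc : ContinuousOn (fun x => |v x| ^ p) (Icc 0 s) :=
    (contDiff_abs_rpow hp).continuous.comp_continuousOn hv.continuousOn
  refine (integral_nonneg fun x => by positivity).lt_of_ne' fun h0 => ?_
  rw [integral_eq_zero_iff_of_nonneg (fun x => by positivity)
    (integrableOn_Ioo_of_continuousOn hc), restrict_Ioo_eq_restrict_Icc] at h0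
  have h1 := Measure.eqOn_Icc_of_ae_eq volume hs.ne h0 hc continuousOn_const
  obtain ⟨x, hx, hvx⟩ := hne
  have h2 : |v x| ^ p = 0 := h1 hx
  exact hvx (by simpa using (Real.rpow_eq_zero (abs_nonneg _) (by linarith)).1 h2)

/-- **Picone's identity** for a positive classical solution `X`: the energy of `v` is the integral of
a nonnegative remainder, which vanishes only if `v` is a multiple of `X`. -/
theorem IsClassicalSolution.picone {p β s μ : ℝ} {X : ℝ → ℝ} (hp : 1 < p) (hs : 0 < s)
    (hX : IsClassicalSolution p β s μ X) (hpos : ∀ x ∈ Icc 0 s, 0 < X x) {v g : ℝ → ℝ}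
    (hv : IsSobolev p s v g) :
    0 ≤ (∫ x in Ioo 0 s, |g x| ^ p) + β * |v s| ^ p - μ * ∫ x in Ioo 0 s, |v x| ^ p ∧
    ((∫ x in Ioo 0 s, |g x| ^ p) + β * |v s| ^ p - μ * ∫ x in Ioo 0 s, |v x| ^ p = 0 →
      ∃ c, ∀ x ∈ Icc 0 s, v x = c * X x) := by
  obtain ⟨D, hD, hXd, -, hXD, hF, h0, h1⟩ := hX.exists_hasACDeriv hp hs
  have hXc := hXD.continuousOn hs
  have hinv : HasACDeriv s (fun x => (X x)⁻¹) (fun x => -D x / X x ^ 2) :=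
    HasACDeriv.of_hasDerivAt hs (hXc.inv₀ fun x hx => (hpos x hx).ne')
      (hD.neg.div (hXc.pow 2) fun x hx => (pow_pos (hpos x hx) 2).ne')
      fun x hx => (hXd x hx).inv (hpos x ⟨hx.1.le, hx.2.le⟩).ne'
  have hu := (hv.hasACDeriv hp hs).mul hinv
  -- The Picone field `|X'|^{p-2} X' X |u|^p`: it is `0` at `0` by the Neumann condition and `-β
  -- |v(s)|^p` at `s` by the Robin condition.
  have hU := (hF.mul hXD).mul (hu.comp (contDiff_abs_rpow hp) (hasDerivAt_abs_rpow_oddPow hp))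
  set u : ℝ → ℝ := fun x => v x * (X x)⁻¹ with hudef
  set R : ℝ → ℝ := fun x =>
    |g x| ^ p - (|D x * u x| ^ p + p * oddPow p (D x * u x) * (g x - D x * u x)) with hR
  have huX : ∀ x ∈ Icc 0 s, u x * X x = v x := fun x hx => by
    simp [hudef, mul_assoc, inv_mul_cancel₀ (hpos x hx).ne']
  have hRn : ∀ x, 0 ≤ R x := fun x => by
    rcases eq_or_ne (D x * u x) (g x) with h | h
    · simp only [hR, h, sub_self, mul_zero, add_zero, le_refl]
    · exact sub_nonneg.2 (abs_rpow_tangent_lt hp h).le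
  have hU' := hU.congr_deriv (g := fun x => |g x| ^ p - μ * |v x| ^ p - R x) (by
    filter_upwards [ae_restrict_mem measurableSet_Ioo] with x hx
    have hx' : x ∈ Icc 0 s := ⟨hx.1.le, hx.2.le⟩
    have hXx := (hpos x hx').ne'
    have e1 : v x * (X x)⁻¹ = u x := rfl
    have e2 : oddPow p (X x) * X x * |u x| ^ p = |v x| ^ p := by
      rw [oddPow_mul_self hp, ← huX x hx', abs_mul_rpow p (u x), mul_comm]
    have e3 : oddPow p (D x) * D x * |u x| ^ p = |D x * u x| ^ p := by
      rw [oddPow_mul_self hp, abs_mul_rpow p (D x)]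
    have e4 : X x * (g x * (X x)⁻¹ + v x * (-D x / X x ^ 2)) = g x - D x * u x := by
      rw [← e1]
      field_simp
      ring
    simp only [hR, ← e2, ← e3, ← e4, oddPow_mul, e1]
    ring)
  have hg := hv.integrable_abs_deriv_rpow hp
  have hvi : IntegrableOn (fun x => μ * |v x| ^ p) (Ioo 0 s) :=
    (integrableOn_Ioo_of_continuousOn
      ((contDiff_abs_rpow hp).continuous.comp_continuousOn hv.continuousOn)).const_mul μ
  -- The remainder is integrable because every other term of the identity is.
  have hRi : IntegrableOn R (Ioo 0 s) := by
    refine ((hg.sub hvi).sub (hU'.integrableOn hs)).congr (.of_forall fun x => ?_)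
    simp
  have hint : (∫ x in Ioo 0 s, |g x| ^ p) + β * |v s| ^ p - μ * ∫ x in Ioo 0 s, |v x| ^ p
      = ∫ x in Ioo 0 s, R x := by
    have h := hU'.integral_eq hs
    have hss : s ∈ Icc 0 s := ⟨hs.le, le_rfl⟩
    have e2 : oddPow p (X s) * X s * |u s| ^ p = |v s| ^ p := by
      rw [oddPow_mul_self hp, ← huX s hss, abs_mul_rpow p (u s), mul_comm]
    have h2 : ∫ x in Ioo 0 s, |g x| ^ p - μ * |v x| ^ p - R x = _ :=
      integral_sub (hg.sub hvi) hRi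
    have h3 : ∫ x in Ioo 0 s, |g x| ^ p - μ * |v x| ^ p = _ :=
      integral_sub hg hvi
    have e3 : v s * (X s)⁻¹ = u s := rfl
    rw [h2, h3, MeasureTheory.integral_const_mul, h0, h1, e3] at h
    rw [← e2]
    linarith
  rw [hint]
  refine ⟨integral_nonneg hRn, fun hz => ?_⟩
  rw [integral_eq_zero_iff_of_nonneg hRn hRi] at hz
  refine ⟨u 0, fun x hx => ?_⟩
  -- `R = 0` a.e. is the equality case of the tangent inequality: `g = X' u`, so `u' = (g - X' u) /
  -- X = 0` and `u` is constant.
  rw [← hu.eqOn_const hs ?_ x hx]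
  · exact (huX x hx).symm
  · filter_upwards [hz, ae_restrict_mem measurableSet_Ioo] with x hRx hx
    have hx' : x ∈ Icc 0 s := ⟨hx.1.le, hx.2.le⟩
    have hXx := (hpos x hx').ne'
    have hgx : D x * u x = g x := by
      by_contra hne
      exact (sub_pos.2 (abs_rpow_tangent_lt hp hne)).ne' hRx
    rw [← hgx]
    simp only [hudef]
    field_simp
    ring

/-! ### The first eigenvalue -/

theorem IsSobolev.rayleigh_eq_iff {p β s r : ℝ} (hp : 1 < p) (hs : 0 < s) {v g : ℝ → ℝ}
    (hv : IsSobolev p s v g) (hne : ∃ x ∈ Icc 0 s, v x ≠ 0) :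
    rayleigh p β s v g = r ↔
      (∫ x in Ioo 0 s, |g x| ^ p) + β * |v s| ^ p - r * ∫ x in Ioo 0 s, |v x| ^ p = 0 := by
  rw [rayleigh, div_eq_iff (hv.integral_abs_rpow_pos hp hs hne).ne', sub_eq_zero]

theorem IsEigenfunction.exists_rayleigh_eq {p β s μ : ℝ} (hp : 1 < p) (hs : 0 < s) {Y : ℝ → ℝ}
    (hY : IsEigenfunction p β s μ Y) :
    ∃ Y' : ℝ → ℝ, IsSobolev p s Y Y' ∧ rayleigh p β s Y Y' = μ := by
  obtain ⟨⟨Y', hYY', hw⟩, hne⟩ := hY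
  refine ⟨Y', hYY', (hYY'.rayleigh_eq_iff hp hs hne).2 ?_⟩
  have h := hw Y Y' hYY'
  simp only [mul_assoc, oddPow_mul_self hp] at h
  linarith

theorem IsClassicalSolution.isEigenfunction {p β s μ : ℝ} {X : ℝ → ℝ} (hp : 1 < p) (hs : 0 < s)
    (hX : IsClassicalSolution p β s μ X) (hpos : ∀ x ∈ Icc 0 s, 0 < X x) :
    IsEigenfunction p β s μ X :=
  ⟨hX.isWeakSolution hp hs, 0, ⟨le_rfl, hs.le⟩, (hpos 0 ⟨le_rfl, hs.le⟩).ne'⟩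

section Positive

variable {p β s μ : ℝ} {X : ℝ → ℝ}

theorem IsClassicalSolution.le_rayleigh (hp : 1 < p) (hs : 0 < s)
    (hX : IsClassicalSolution p β s μ X) (hpos : ∀ x ∈ Icc 0 s, 0 < X x) {v g : ℝ → ℝ}
    (hv : IsSobolev p s v g) (hne : ∃ x ∈ Icc 0 s, v x ≠ 0) : μ ≤ rayleigh p β s v g := by
  rw [rayleigh, le_div_iff₀ (hv.integral_abs_rpow_pos hp hs hne)]
  linarith [(hX.picone hp hs hpos hv).1]

theorem IsClassicalSolution.isLeast_eigenvalue (hp : 1 < p) (hs : 0 < s)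
    (hX : IsClassicalSolution p β s μ X) (hpos : ∀ x ∈ Icc 0 s, 0 < X x) :
    IsLeast {ν : ℝ | IsEigenvalue p β s ν} μ := by
  refine ⟨⟨X, hX.isEigenfunction hp hs hpos⟩, fun ν ⟨Y, hY⟩ => ?_⟩
  obtain ⟨Y', hYY', hr⟩ := hY.exists_rayleigh_eq hp hs
  exact hr ▸ hX.le_rayleigh hp hs hpos hYY' hY.2

theorem neumannRayleighValues_subset (p β s : ℝ) :
    neumannRayleighValues p β s ⊆ rayleighValues p β s := by
  rintro r ⟨v, g, hv, hne, -, hr⟩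
  exact ⟨v, g, hv, hne, hr⟩

theorem IsClassicalSolution.isLeast_neumannRayleighValues (hp : 1 < p) (hs : 0 < s)
    (hX : IsClassicalSolution p β s μ X) (hpos : ∀ x ∈ Icc 0 s, 0 < X x) :
    IsLeast (neumannRayleighValues p β s) μ := by
  refine ⟨?_, fun r ⟨v, g, hv, hne, _, hr⟩ => hr ▸ hX.le_rayleigh hp hs hpos hv hne⟩
  have hE := hX.isEigenfunction hp hs hpos
  obtain ⟨X', hXX', hr⟩ := hE.exists_rayleigh_eq hp hs
  obtain ⟨-, -, -, hd, -⟩ := hX.exists_hasACDeriv hp hs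
  exact ⟨X, X', hXX', hE.2, ⟨0, hd, oddPow_zero p⟩, hr.symm⟩

theorem IsClassicalSolution.isLeast_rayleighValues (hp : 1 < p) (hs : 0 < s)
    (hX : IsClassicalSolution p β s μ X) (hpos : ∀ x ∈ Icc 0 s, 0 < X x) :
    IsLeast (rayleighValues p β s) μ :=
  ⟨neumannRayleighValues_subset p β s (hX.isLeast_neumannRayleighValues hp hs hpos).1,
    fun _ ⟨_, _, hv, hne, hr⟩ => hr ▸ hX.le_rayleigh hp hs hpos hv hne⟩

theorem IsClassicalSolution.eigenfunction_eq_const_mul (hp : 1 < p) (hs : 0 < s)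
    (hX : IsClassicalSolution p β s μ X) (hpos : ∀ x ∈ Icc 0 s, 0 < X x) {Y : ℝ → ℝ}
    (hY : IsEigenfunction p β s μ Y) : ∃ c ≠ 0, ∀ x ∈ Icc 0 s, Y x = c * X x := by
  obtain ⟨Y', hYY', hr⟩ := hY.exists_rayleigh_eq hp hs
  rw [hYY'.rayleigh_eq_iff hp hs hY.2] at hr
  obtain ⟨c, hc⟩ := (hX.picone hp hs hpos hYY').2 hr
  refine ⟨c, ?_, hc⟩
  rintro rfl
  obtain ⟨x, hx, hne⟩ := hY.2
  exact hne (by simp [hc x hx])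

end Positive

/-! ### Inverse functions -/

/-- Compactness: within `S`, the preimage under `g` of a closed `t` is the image under `A` of the
compact set `[a, b] ∩ t`. -/
theorem continuousOn_of_rightInverse {A g : ℝ → ℝ} {a b : ℝ} {S : Set ℝ}
    (hA : ContinuousOn A (Icc a b)) (hinj : InjOn A (Icc a b)) (hg : MapsTo g S (Icc a b))
    (hAg : ∀ y ∈ S, A (g y) = y) : ContinuousOn g S := by
  rw [continuousOn_iff_isClosed]
  intro t ht
  have hc : IsCompact (A '' (Icc a b ∩ t)) :=
    (isCompact_Icc.inter_right ht).image_of_continuousOn (hA.mono inter_subset_left)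
  refine ⟨_, hc.isClosed, ?_⟩
  ext y
  constructor
  · rintro ⟨h1, h2⟩
    exact ⟨⟨g y, ⟨hg h2, h1⟩, hAg y h2⟩, h2⟩
  · rintro ⟨⟨x, ⟨hx, hxt⟩, hxy⟩, h2⟩
    refine ⟨?_, h2⟩
    have : x = g y := hinj hx (hg h2) (by rw [hxy, hAg y h2])
    rwa [mem_preimage, ← this]

/-! ### The generalized cosine -/

section Cos

variable {p : ℝ}

theorem one_sub_rpow_pos (hp : 1 < p) {t : ℝ} (h0 : 0 ≤ t) (h1 : t < 1) : 0 < 1 - t ^ p :=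
  sub_pos.2 (Real.rpow_lt_one h0 h1 (by linarith))

/-- On `[0, 1]`, `t^p ≤ t`, so the integrand is dominated by `(1 - t)^{-1/p}`, integrable since `1/p
< 1`. -/
theorem intervalIntegrable_arccosP (hp : 1 < p) :
    IntervalIntegrable (fun t : ℝ => 1 / (1 - t ^ p) ^ (1 / p)) volume 0 1 := by
  have hp0 : 0 < p := by linarith
  have h1 : IntervalIntegrable (fun t : ℝ => (1 - t) ^ (-(1 / p))) volume 0 1 := by
    have h := (intervalIntegrable_rpow' (a := 0) (b := 1) (r := -(1 / p))
      (by rw [neg_lt_neg_iff, div_lt_one hp0]; exact hp)).comp_sub_left 1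
    simpa using h.symm
  refine h1.mono_fun' (by fun_prop : Measurable _).aestronglyMeasurable ?_
  rw [uIoc_of_le zero_le_one]
  filter_upwards [ae_restrict_mem measurableSet_Ioc] with t ht
  rcases ht.2.eq_or_lt with rfl | ht1
  -- At `t = 1` the integrand has the default value `1 / 0 = 0`.
  · simp [Real.zero_rpow (inv_pos.2 hp0).ne', Real.rpow_nonneg]
  · have h2 : 1 - t ≤ 1 - t ^ p := by
      have := Real.rpow_le_rpow_of_exponent_ge ht.1 ht.2 hp.le
      rw [Real.rpow_one] at this
      linarith
    have h3 := one_sub_rpow_pos hp ht.1.le ht1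
    rw [Real.norm_of_nonneg (by positivity), Real.rpow_neg (by linarith), ← one_div]
    have h4 : 0 < 1 - t := by linarith
    exact one_div_le_one_div_of_le (by positivity)
      (Real.rpow_le_rpow h4.le h2 (by positivity))

theorem continuousOn_arccosP (hp : 1 < p) : ContinuousOn (arccosP p) (Icc 0 1) := by
  have h := continuousOn_primitive_interval' (intervalIntegrable_arccosP hp)
    (right_mem_uIcc (a := (0 : ℝ)) (b := 1))
  rw [uIcc_of_le zero_le_one] at h
  refine h.neg.congr fun x _ => ?_
  rw [arccosP, integral_symm]
  rfl

theorem hasDerivAt_arccosP (hp : 1 < p) {x : ℝ} (hx : x ∈ Ioo 0 1) :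
    HasDerivAt (arccosP p) (-(1 / (1 - x ^ p) ^ (1 / p))) x := by
  have hint := (intervalIntegrable_arccosP hp).mono_set
    (c := x) (d := 1) (by
      rw [uIcc_of_le zero_le_one, uIcc_of_le hx.2.le]; exact Icc_subset_Icc_left hx.1.le)
  refine integral_hasDerivAt_left hint
    (by fun_prop : Measurable _).stronglyMeasurable.stronglyMeasurableAtFilter ?_
  have := one_sub_rpow_pos hp hx.1.le hx.2
  have h1 : ContinuousAt (fun t : ℝ => 1 - t ^ p) x :=
    continuousAt_const.sub (Real.continuousAt_rpow_const x p (.inl hx.1.ne'))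
  exact continuousAt_const.div (h1.rpow_const (.inl this.ne')) (by positivity)

theorem strictAntiOn_arccosP (hp : 1 < p) : StrictAntiOn (arccosP p) (Icc 0 1) := by
  refine strictAntiOn_of_deriv_neg (convex_Icc 0 1) (continuousOn_arccosP hp) fun x hx => ?_
  rw [interior_Icc] at hx
  rw [(hasDerivAt_arccosP hp hx).deriv]
  have := one_sub_rpow_pos hp hx.1.le hx.2
  exact neg_neg_of_pos (by positivity)

theorem arccosP_one (p : ℝ) : arccosP p 1 = 0 := integral_same

theorem arccosP_zero (p : ℝ) : arccosP p 0 = piP p / 2 := by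
  rw [arccosP, piP]; ring

theorem piP_pos (hp : 1 < p) : 0 < piP p := by
  have := strictAntiOn_arccosP hp ⟨le_rfl, zero_le_one⟩ ⟨zero_le_one, le_rfl⟩ zero_lt_one
  rw [arccosP_one, arccosP_zero] at this
  linarith

theorem image_arccosP (hp : 1 < p) : Icc 0 (piP p / 2) ⊆ arccosP p '' Icc 0 1 := by
  have := intermediate_value_Icc' zero_le_one (continuousOn_arccosP hp)
  rwa [arccosP_one, arccosP_zero] at this

/-- Here `t / (2 π_p) ≤ 1/4` rounds to `0`. Only this quarter period is ever used. -/
theorem cosP_eq_branch (hp : 1 < p) {t : ℝ} (ht : t ∈ Icc 0 (piP p / 2)) :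
    cosP p t = cosPBranch p t := by
  have hπ := piP_pos hp
  have hr : round (t / (2 * piP p)) = 0 := by
    rw [round_eq_zero_iff]
    constructor
    · have : 0 ≤ t / (2 * piP p) := div_nonneg ht.1 (by linarith)
      linarith
    · rw [div_lt_iff₀ (by linarith)]
      linarith [ht.2]
  simp only [cosP, hr, Int.cast_zero, mul_zero, sub_zero, abs_of_nonneg ht.1, if_pos ht.2]

theorem cosP_mem (hp : 1 < p) {t : ℝ} (ht : t ∈ Icc 0 (piP p / 2)) : cosP p t ∈ Icc 0 1 := by
  rw [cosP_eq_branch hp ht]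
  exact Function.invFunOn_mem (image_arccosP hp ht)

theorem arccosP_cosP (hp : 1 < p) {t : ℝ} (ht : t ∈ Icc 0 (piP p / 2)) :
    arccosP p (cosP p t) = t := by
  rw [cosP_eq_branch hp ht]
  exact Function.invFunOn_eq (image_arccosP hp ht)

theorem strictAntiOn_cosP (hp : 1 < p) : StrictAntiOn (cosP p) (Icc 0 (piP p / 2)) := by
  intro x hx y hy hxy
  rw [← (strictAntiOn_arccosP hp).lt_iff_gt (cosP_mem hp hx) (cosP_mem hp hy),
    arccosP_cosP hp hx, arccosP_cosP hp hy]
  exact hxy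

theorem cosP_zero (hp : 1 < p) : cosP p 0 = 1 := by
  have h0 : (0 : ℝ) ∈ Icc 0 (piP p / 2) := ⟨le_rfl, by linarith [piP_pos hp]⟩
  refine (strictAntiOn_arccosP hp).injOn (cosP_mem hp h0) ⟨zero_le_one, le_rfl⟩ ?_
  rw [arccosP_cosP hp h0, arccosP_one]

theorem cosP_pi_div_two (hp : 1 < p) : cosP p (piP p / 2) = 0 := by
  have h0 : piP p / 2 ∈ Icc 0 (piP p / 2) := ⟨by linarith [piP_pos hp], le_rfl⟩
  refine (strictAntiOn_arccosP hp).injOn (cosP_mem hp h0) ⟨le_rfl, zero_le_one⟩ ?_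
  rw [arccosP_cosP hp h0, arccosP_zero]

theorem continuousOn_cosP (hp : 1 < p) : ContinuousOn (cosP p) (Icc 0 (piP p / 2)) :=
  continuousOn_of_rightInverse (continuousOn_arccosP hp) (strictAntiOn_arccosP hp).injOn
    (fun _ => cosP_mem hp) fun _ => arccosP_cosP hp

theorem cosP_pos (hp : 1 < p) {t : ℝ} (ht : t ∈ Ico 0 (piP p / 2)) : 0 < cosP p t := by
  rw [← cosP_pi_div_two hp]
  exact strictAntiOn_cosP hp ⟨ht.1, ht.2.le⟩ ⟨ht.1.trans ht.2.le, le_rfl⟩ ht.2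

theorem cosP_lt_one (hp : 1 < p) {t : ℝ} (ht : t ∈ Ioc 0 (piP p / 2)) : cosP p t < 1 := by
  rw [← cosP_zero hp]
  exact strictAntiOn_cosP hp ⟨le_rfl, ht.1.le.trans ht.2⟩ ⟨ht.1.le, ht.2⟩ ht.1

/-- Inverse function rule. The endpoint `0` is excluded because the derivative of `arccos_p` blows
up at `1`. -/
theorem hasDerivAt_cosP (hp : 1 < p) {t : ℝ} (ht : t ∈ Ioo 0 (piP p / 2)) :
    HasDerivAt (cosP p) (-(1 - cosP p t ^ p) ^ (1 / p)) t := by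
  have hc : cosP p t ∈ Ioo 0 1 := ⟨cosP_pos hp ⟨ht.1.le, ht.2⟩, cosP_lt_one hp ⟨ht.1, ht.2.le⟩⟩
  have h := one_sub_rpow_pos hp hc.1.le hc.2
  have hd := HasDerivAt.of_local_left_inverse
    ((continuousOn_cosP hp).continuousAt (Icc_mem_nhds ht.1 ht.2)) (hasDerivAt_arccosP hp hc)
    (neg_ne_zero.2 (by positivity)) (by
      filter_upwards [Icc_mem_nhds ht.1 ht.2] with y hy using arccosP_cosP hp hy)
  simpa [inv_neg] using hd

end Cos

/-! ### The generalized hyperbolic cosine -/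

section Cosh

variable {p : ℝ}

theorem rpow_sub_one_pos (hp : 1 < p) {t : ℝ} (h1 : 1 < t) : 0 < t ^ p - 1 :=
  sub_pos.2 (Real.one_lt_rpow h1 (by linarith))

theorem intervalIntegrable_arccoshP (hp : 1 < p) {M : ℝ} (hM : 1 ≤ M) :
    IntervalIntegrable (fun t : ℝ => 1 / (t ^ p - 1) ^ (1 / p)) volume 1 M := by
  have hp0 : 0 < p := by linarith
  have h1 : IntervalIntegrable (fun t : ℝ => (t - 1) ^ (-(1 / p))) volume 1 M := by
    have h := (intervalIntegrable_rpow' (a := 0) (b := M - 1) (r := -(1 / p))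
      (by rw [neg_lt_neg_iff, div_lt_one hp0]; exact hp)).comp_sub_right 1
    simpa using h
  refine h1.mono_fun' (by fun_prop : Measurable _).aestronglyMeasurable ?_
  rw [uIoc_of_le hM]
  filter_upwards [ae_restrict_mem measurableSet_Ioc] with t ht
  have h2 : t - 1 ≤ t ^ p - 1 := by
    have := Real.rpow_le_rpow_of_exponent_le ht.1.le hp.le
    rw [Real.rpow_one] at this
    linarith
  have h3 := rpow_sub_one_pos hp ht.1
  have h4 : 0 < t - 1 := by linarith [ht.1]
  rw [Real.norm_of_nonneg (by positivity), Real.rpow_neg h4.le, ← one_div]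
  exact one_div_le_one_div_of_le (by positivity)
    (Real.rpow_le_rpow h4.le h2 (by positivity))

theorem continuousOn_arccoshP_Icc (hp : 1 < p) {M : ℝ} (hM : 1 ≤ M) :
    ContinuousOn (arccoshP p) (Icc 1 M) := by
  have h := continuousOn_primitive_interval' (intervalIntegrable_arccoshP hp hM)
    (left_mem_uIcc (a := (1 : ℝ)) (b := M))
  rwa [uIcc_of_le hM] at h

theorem hasDerivAt_arccoshP (hp : 1 < p) {x : ℝ} (hx : 1 < x) :
    HasDerivAt (arccoshP p) (1 / (x ^ p - 1) ^ (1 / p)) x := by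
  refine integral_hasDerivAt_right (intervalIntegrable_arccoshP hp hx.le)
    (by fun_prop : Measurable _).stronglyMeasurable.stronglyMeasurableAtFilter ?_
  have := rpow_sub_one_pos hp hx
  have h1 : ContinuousAt (fun t : ℝ => t ^ p - 1) x :=
    (Real.continuousAt_rpow_const x p (.inl (by linarith))).sub continuousAt_const
  exact continuousAt_const.div (h1.rpow_const (.inl this.ne')) (by positivity)

theorem continuousOn_arccoshP (hp : 1 < p) : ContinuousOn (arccoshP p) (Ici 1) := by
  intro x hx
  have hx : 1 ≤ x := hx
  refine ((continuousOn_arccoshP_Icc hp (M := x + 1) (by linarith)) x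
    ⟨hx, by linarith⟩).mono_of_mem_nhdsWithin ?_
  rw [← Ici_inter_Iic]
  exact inter_mem self_mem_nhdsWithin (nhdsWithin_le_nhds (Iic_mem_nhds (by linarith)))

theorem strictMonoOn_arccoshP (hp : 1 < p) : StrictMonoOn (arccoshP p) (Ici 1) := by
  refine strictMonoOn_of_deriv_pos (convex_Ici 1) (continuousOn_arccoshP hp) fun x hx => ?_
  rw [interior_Ici] at hx
  rw [(hasDerivAt_arccoshP hp hx).deriv]
  have := rpow_sub_one_pos hp hx
  positivity

theorem arccoshP_one (p : ℝ) : arccoshP p 1 = 0 := integral_same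

/-- The integrand is at least `1 / t`. This makes `arccosh_p` unbounded, so `cosh_p` is a true
inverse on all of `[0, ∞)`. -/
theorem log_le_arccoshP (hp : 1 < p) {M : ℝ} (hM : 1 ≤ M) : Real.log M ≤ arccoshP p M := by
  have h : ∫ t in (1 : ℝ)..M, 1 / t = Real.log M := by
    rw [integral_one_div_of_pos one_pos (by linarith), div_one]
  rw [← h, arccoshP]
  refine integral_mono_on_of_le_Ioo hM ?_ (intervalIntegrable_arccoshP hp hM) fun t ht => ?_
  · refine ContinuousOn.intervalIntegrable_of_Icc hM fun t ht => ?_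
    have : t ≠ 0 := by linarith [ht.1]
    fun_prop (disch := assumption)
  · have h0 : 0 < t := by linarith [ht.1]
    have h1 := rpow_sub_one_pos hp ht.1
    refine one_div_le_one_div_of_le (by positivity) ?_
    calc (t ^ p - 1) ^ (1 / p) ≤ (t ^ p) ^ (1 / p) :=
          Real.rpow_le_rpow h1.le (by linarith) (by positivity)
      _ = t := by rw [one_div, Real.rpow_rpow_inv h0.le (by linarith)]

theorem exists_le_arccoshP (hp : 1 < p) (θ : ℝ) : ∃ M, 1 ≤ M ∧ θ ≤ arccoshP p M := by
  refine ⟨Real.exp |θ|, Real.one_le_exp (abs_nonneg θ), ?_⟩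
  refine (le_abs_self θ).trans ?_
  conv_lhs => rw [← Real.log_exp |θ|]
  exact log_le_arccoshP hp (Real.one_le_exp (abs_nonneg θ))

theorem image_arccoshP (hp : 1 < p) : Ici 0 ⊆ arccoshP p '' Ici 1 := by
  intro θ hθ
  obtain ⟨M, hM, hle⟩ := exists_le_arccoshP hp θ
  have := intermediate_value_Icc hM (continuousOn_arccoshP_Icc hp hM)
  rw [arccoshP_one] at this
  exact image_mono Icc_subset_Ici_self (this ⟨hθ, hle⟩)

theorem one_le_coshP (hp : 1 < p) (t : ℝ) : 1 ≤ coshP p t :=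
  Function.invFunOn_mem (image_arccoshP hp (abs_nonneg t))

theorem arccoshP_coshP (hp : 1 < p) {t : ℝ} (ht : 0 ≤ t) : arccoshP p (coshP p t) = t := by
  rw [coshP, abs_of_nonneg ht]
  exact Function.invFunOn_eq (image_arccoshP hp ht)

theorem strictMonoOn_coshP (hp : 1 < p) : StrictMonoOn (coshP p) (Ici 0) := by
  intro x hx y hy hxy
  rw [← (strictMonoOn_arccoshP hp).lt_iff_lt (one_le_coshP hp x) (one_le_coshP hp y),
    arccoshP_coshP hp hx, arccoshP_coshP hp hy]
  exact hxy

theorem coshP_zero (hp : 1 < p) : coshP p 0 = 1 := by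
  refine (strictMonoOn_arccoshP hp).injOn (one_le_coshP hp 0) (le_refl (1 : ℝ)) ?_
  rw [arccoshP_coshP hp le_rfl, arccoshP_one]

theorem one_lt_coshP (hp : 1 < p) {t : ℝ} (ht : 0 < t) : 1 < coshP p t := by
  rw [← coshP_zero hp]
  exact strictMonoOn_coshP hp (le_refl (0 : ℝ)) ht.le ht

theorem continuousOn_coshP_Icc (hp : 1 < p) (θ : ℝ) : ContinuousOn (coshP p) (Icc 0 θ) := by
  refine continuousOn_of_rightInverse (continuousOn_arccoshP_Icc hp (one_le_coshP hp θ))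
    ((strictMonoOn_arccoshP hp).injOn.mono Icc_subset_Ici_self) (fun t ht => ?_)
    fun t ht => arccoshP_coshP hp ht.1
  exact ⟨one_le_coshP hp t, (strictMonoOn_coshP hp).monotoneOn ht.1 (ht.1.trans ht.2) ht.2⟩

theorem hasDerivAt_coshP (hp : 1 < p) {t : ℝ} (ht : 0 < t) :
    HasDerivAt (coshP p) ((coshP p t ^ p - 1) ^ (1 / p)) t := by
  have h := rpow_sub_one_pos hp (one_lt_coshP hp ht)
  have hd := HasDerivAt.of_local_left_inverse
    ((continuousOn_coshP_Icc hp (t + 1)).continuousAt (Icc_mem_nhds ht (by linarith)))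
    (hasDerivAt_arccoshP hp (one_lt_coshP hp ht)) (by positivity) (by
      filter_upwards [Ioi_mem_nhds ht] with y hy using arccoshP_coshP hp (le_of_lt hy))
  simpa using hd

end Cosh

/-! ### Rescaled profiles solve the problem -/

/-- At an endpoint the one-sided derivative is the limit of the interior derivatives. This supplies
the derivative of the profiles at `0`, out of reach of the inverse function rule. -/
theorem hasDerivWithinAt_Icc_of_Ioo {s : ℝ} (hs : 0 < s) {f g : ℝ → ℝ}
    (hf : ContinuousOn f (Icc 0 s)) (hg : ContinuousOn g (Icc 0 s))
    (h : ∀ x ∈ Ioo 0 s, HasDerivAt f (g x) x) :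
    ∀ x ∈ Icc 0 s, HasDerivWithinAt f (g x) (Icc 0 s) x := by
  have hdiff : DifferentiableOn ℝ f (Ioo 0 s) := fun x hx =>
    (h x hx).differentiableAt.differentiableWithinAt
  intro x hx
  rcases hx.1.eq_or_lt with rfl | h0
  · refine (hasDerivWithinAt_Ici_of_tendsto_deriv hdiff ((hf 0 hx).mono Ioo_subset_Icc_self)
      (Ioo_mem_nhdsGT hs) ?_).mono Icc_subset_Ici_self
    have hg0 : Tendsto g (𝓝[>] 0) (𝓝 (g 0)) := by
      rw [← nhdsWithin_Ioo_eq_nhdsGT hs]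
      exact ((hg 0 hx).mono Ioo_subset_Icc_self).tendsto
    refine hg0.congr' ?_
    filter_upwards [Ioo_mem_nhdsGT hs] with y hy using (h y hy).deriv.symm
  rcases hx.2.eq_or_lt with rfl | h1
  · refine (hasDerivWithinAt_Iic_of_tendsto_deriv hdiff ((hf x hx).mono Ioo_subset_Icc_self)
      (Ioo_mem_nhdsLT hs) ?_).mono Icc_subset_Iic_self
    have hg0 : Tendsto g (𝓝[<] x) (𝓝 (g x)) := by
      rw [← nhdsWithin_Ioo_eq_nhdsLT hs]
      exact ((hg x hx).mono Ioo_subset_Icc_self).tendsto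
    refine hg0.congr' ?_
    filter_upwards [Ioo_mem_nhdsLT hs] with y hy using (h y hy).deriv.symm
  · exact (h x ⟨h0, h1⟩).hasDerivWithinAt

/-- Rescaling a positive profile with `C(0) = 1` and `|C'|^p = ε (1 - C^p)`, where `ε = ±1`, gives a
classical solution as soon as the Robin condition holds. -/
theorem isClassicalSolution_of_profile {p β s k ε : ℝ} (hp : 1 < p) (hs : 0 < s) (hk : 0 < k)
    (hε : ε * ε = 1) (hβ : β = ε * |β|) {C : ℝ → ℝ} (hC : ContinuousOn C (Icc 0 (k * s)))
    (hC0 : C 0 = 1) (hpos : ∀ t ∈ Icc 0 (k * s), 0 < C t)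
    (hE : ∀ t ∈ Ioc 0 (k * s), 0 < ε * (1 - C t ^ p))
    (hd : ∀ t ∈ Ioo 0 (k * s), HasDerivAt C (-ε * (ε * (1 - C t ^ p)) ^ (1 / p)) t)
    (hbc : k ^ p * (ε * (1 - C (k * s) ^ p)) = |β| ^ (p / (p - 1)) * C (k * s) ^ p) :
    IsClassicalSolution p β s (ε * (p - 1) * k ^ p) fun x => C (k * x) := by
  have hp0 : 0 < p := by linarith
  have hks : 0 < k * s := mul_pos hk hs
  set E : ℝ → ℝ := fun t => ε * (1 - C t ^ p) with hEdef
  set D : ℝ → ℝ := fun t => -ε * E t ^ (1 / p) with hDdef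
  have hεp : oddPow p ε = ε := by
    rcases mul_self_eq_one_iff.1 hε with rfl | rfl <;> simp [oddPow]
  have hEc : ContinuousOn E (Icc 0 (k * s)) :=
    continuousOn_const.mul (continuousOn_const.sub (hC.rpow_const fun t ht =>
      .inl (hpos t ht).ne'))
  have hDc : ContinuousOn D (Icc 0 (k * s)) :=
    continuousOn_const.mul (hEc.rpow_const fun t ht => .inr (by positivity))
  have hflux : ∀ t, 0 ≤ E t → oddPow p (D t) = -ε * E t ^ ((p - 1) / p) := fun t ht => by
    rw [hDdef, oddPow_mul, oddPow_neg, hεp, oddPow_of_nonneg hp (by positivity),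
      ← Real.rpow_mul ht, one_div_mul_eq_div]
  have hfluxd : ∀ t ∈ Ioo 0 (k * s),
      HasDerivAt (fun t => oddPow p (D t)) (-ε * (p - 1) * C t ^ (p - 1)) t := fun t ht => by
    have hEt := hE t ⟨ht.1, ht.2.le⟩
    have hCt := hpos t ⟨ht.1.le, ht.2.le⟩
    have h1 : HasDerivAt E (ε * (0 - D t * p * C t ^ (p - 1))) t :=
      ((hasDerivAt_const t (1 : ℝ)).sub ((hd t ht).rpow_const (.inl hCt.ne'))).const_mul ε
    have h2 := (h1.rpow_const (p := (p - 1) / p) (.inl hEt.ne')).const_mul (-ε)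
    -- The chain rule brings in `C' = -ε E^{1/p}`, which cancels the remaining power of `E`; this is
    -- why the flux has derivative `-ε (p-1) C^{p-1}`.
    have h3 : E t ^ ((p - 1) / p - 1) * E t ^ (1 / p) = 1 := by
      rw [← Real.rpow_add hEt]
      convert Real.rpow_zero _ using 2
      field_simp
      ring
    refine (h2.congr_of_eventuallyEq ?_).congr_deriv ?_
    · filter_upwards [Ioo_mem_nhds ht.1 ht.2] with y hy
      exact hflux y (hE y ⟨hy.1, hy.2.le⟩).le
    · have h4 : p * ((p - 1) / p) = p - 1 := by field_simp
      calc -ε * (ε * (0 - D t * p * C t ^ (p - 1)) * ((p - 1) / p) * E t ^ ((p - 1) / p - 1))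
          = -ε * (ε * ε) * (p * ((p - 1) / p)) * C t ^ (p - 1)
              * (E t ^ ((p - 1) / p - 1) * E t ^ (1 / p)) := by
            simp only [hDdef]; ring
        _ = -ε * (p - 1) * C t ^ (p - 1) := by rw [hε, h3, h4]; ring
  have hmaps : MapsTo (fun x => k * x) (Icc 0 s) (Icc 0 (k * s)) := fun x hx =>
    ⟨mul_nonneg hk.le hx.1, mul_le_mul_of_nonneg_left hx.2 hk.le⟩
  have hmaps' : ∀ x ∈ Ioo 0 s, k * x ∈ Ioo 0 (k * s) := fun x hx =>
    ⟨mul_pos hk hx.1, mul_lt_mul_of_pos_left hx.2 hk⟩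
  have hlin : ∀ x, HasDerivAt (fun x : ℝ => k * x) k x := fun x => by
    simpa using (hasDerivAt_id x).const_mul k
  have hlc : ContinuousOn (fun x : ℝ => k * x) (Icc 0 s) := by fun_prop
  have hX'c : ContinuousOn (fun x => k * D (k * x)) (Icc 0 s) :=
    continuousOn_const.mul (hDc.comp hlc hmaps)
  refine ⟨fun x => k * D (k * x), hX'c,
    hasDerivWithinAt_Icc_of_Ioo hs (hC.comp hlc hmaps) hX'c fun x hx => ?_, fun x hx => ?_, ?_, ?_⟩
  · rw [mul_comm]
    exact (hd _ (hmaps' x hx)).comp x (hlin x)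
  · refine ⟨k ^ (p - 1) * (-ε * (p - 1) * C (k * x) ^ (p - 1) * k), ?_, ?_⟩
    · simp only [oddPow_mul, oddPow_of_nonneg hp hk.le]
      exact ((hfluxd _ (hmaps' x hx)).comp x (hlin x)).const_mul _
    · have hCx := hpos _ (hmaps ⟨hx.1.le, hx.2.le⟩)
      have hkp : k ^ p = k ^ (p - 1) * k := by
        rw [← Real.rpow_add_one hk.ne', sub_add_cancel]
      rw [oddPow_of_nonneg hp hCx.le, hkp]
      ring
  · have hE0 : E 0 = 0 := by simp [hEdef, hC0]
    simp only [mul_zero, hDdef, hE0]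
    rw [Real.zero_rpow (by positivity), mul_zero, mul_zero, oddPow_zero]
  · have hss : k * s ∈ Ioc 0 (k * s) := ⟨hks, le_rfl⟩
    have hEs : 0 < E (k * s) := hE _ hss
    have hCs : 0 < C (k * s) := hpos _ ⟨hks.le, le_rfl⟩
    have hpp : p * ((p - 1) / p) = p - 1 := by field_simp
    have hpp' : p / (p - 1) * ((p - 1) / p) = 1 := by
      have : p - 1 ≠ 0 := by linarith
      field_simp
    -- The hypothesis `hbc` raised to the power `(p-1)/p = 1/p'`, which is the Robin condition up to
    -- sign.
    have h : k ^ (p - 1) * E (k * s) ^ ((p - 1) / p) = |β| * C (k * s) ^ (p - 1) := by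
      have hbc' : k ^ p * E (k * s) = |β| ^ (p / (p - 1)) * C (k * s) ^ p := hbc
      have : (k ^ p * E (k * s)) ^ ((p - 1) / p)
          = (|β| ^ (p / (p - 1)) * C (k * s) ^ p) ^ ((p - 1) / p) := by rw [hbc']
      rwa [Real.mul_rpow (by positivity) hEs.le,
        Real.mul_rpow (x := |β| ^ (p / (p - 1))) (by positivity) (by positivity),
        ← Real.rpow_mul hk.le, ← Real.rpow_mul (abs_nonneg β), ← Real.rpow_mul hCs.le, hpp, hpp',
        Real.rpow_one] at this
    simp only [oddPow_mul]
    rw [oddPow_of_nonneg hp hk.le, hflux _ hEs.le, oddPow_of_nonneg hp hCs.le]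
    rw [hβ]
    linear_combination (-ε) * h

/-! ### The characteristic equations -/

/-- The cleared form extends continuously to `c = 1` and `c = 0`, the ends of the quarter period,
where the intermediate value theorem is applied. -/
theorem cosEquation_aux {p B c m : ℝ} (hp : 1 < p) (hc0 : 0 < c) (hc1 : c < 1) :
    m = B / (c ^ (-p) - 1) ↔ m * (1 - c ^ p) = B * c ^ p := by
  have h1 : 0 < c ^ p := by positivity
  have h2 := one_sub_rpow_pos hp hc0.le hc1
  have h3 : c ^ (-p) - 1 = (1 - c ^ p) / c ^ p := by
    rw [Real.rpow_neg hc0.le]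
    field_simp
  rw [h3, div_div_eq_mul_div, eq_div_iff h2.ne']

theorem coshEquation_aux {p B c m : ℝ} (hp : 1 < p) (hc1 : 1 < c) :
    m = B / (1 - c ^ (-p)) ↔ m * (1 - c ^ (-p)) = B := by
  have h1 : c ^ (-p) < 1 := Real.rpow_lt_one_of_one_lt_of_neg hc1 (by linarith)
  rw [eq_div_iff (by linarith)]

section CosCharacteristic

variable {p s B : ℝ}

/-- On the quarter period `cos_p` decreases: the first term is a product of nonnegative
nondecreasing factors, and the term with `B > 0` gives strictness. -/
theorem strictMonoOn_cosCharacteristic (hp : 1 < p) (hs : 0 < s) (hB : 0 < B) :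
    StrictMonoOn (fun k => k ^ p * (1 - cosP p (k * s) ^ p) - B * cosP p (k * s) ^ p)
      (Icc 0 (piP p / 2 / s)) := by
  intro a ha b hb hab
  have hp0 : 0 < p := by linarith
  have hmem : ∀ k ∈ Icc 0 (piP p / 2 / s), k * s ∈ Icc 0 (piP p / 2) := fun k hk =>
    ⟨mul_nonneg hk.1 hs.le, (le_div_iff₀ hs).1 hk.2⟩
  have hca := cosP_mem hp (hmem a ha)
  have hcb := cosP_mem hp (hmem b hb)
  have h1 : cosP p (b * s) < cosP p (a * s) :=
    strictAntiOn_cosP hp (hmem a ha) (hmem b hb) (mul_lt_mul_of_pos_right hab hs)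
  have h2 : cosP p (b * s) ^ p < cosP p (a * s) ^ p := Real.rpow_lt_rpow hcb.1 h1 hp0
  have h3 : a ^ p ≤ b ^ p := Real.rpow_le_rpow ha.1 hab.le hp0.le
  have h4 : cosP p (a * s) ^ p ≤ 1 := Real.rpow_le_one hca.1 hca.2 hp0.le
  have h5 : a ^ p * (1 - cosP p (a * s) ^ p) ≤ b ^ p * (1 - cosP p (b * s) ^ p) :=
    mul_le_mul h3 (by linarith) (by linarith) (Real.rpow_nonneg hb.1 p)
  have h6 := mul_lt_mul_of_pos_left h2 hB
  simp only
  linarith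

/-- The function is `-B` at `k = 0` and `k^p > 0` at `k = π_p / (2 s)`. A root strictly inside keeps
`cos_p (k x)` positive on `[0, s]`. -/
theorem exists_cosCharacteristic_eq_zero (hp : 1 < p) (hs : 0 < s) (hB : 0 < B) :
    ∃ k ∈ Ioo 0 (piP p / 2 / s),
      k ^ p * (1 - cosP p (k * s) ^ p) - B * cosP p (k * s) ^ p = 0 := by
  have hp0 : 0 < p := by linarith
  have hK : 0 < piP p / 2 / s := by have := piP_pos hp; positivity
  have hc : ContinuousOn (fun k => cosP p (k * s) ^ p) (Icc 0 (piP p / 2 / s)) :=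
    ((continuousOn_cosP hp).comp (by fun_prop) fun k hk =>
      ⟨mul_nonneg hk.1 hs.le, (le_div_iff₀ hs).1 hk.2⟩).rpow_const fun _ _ => .inr hp0.le
  have hc' : ContinuousOn (fun k => k ^ p * (1 - cosP p (k * s) ^ p) - B * cosP p (k * s) ^ p)
      (Icc 0 (piP p / 2 / s)) :=
    ((continuousOn_id.rpow_const fun _ _ => .inr hp0.le).mul (continuousOn_const.sub hc)).sub
      (continuousOn_const.mul hc)
  have h0 := intermediate_value_Ioo hK.le hc'
  simp only [zero_mul, cosP_zero hp, div_mul_cancel₀ _ hs.ne', cosP_pi_div_two hp,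
    Real.zero_rpow hp0.ne', Real.one_rpow] at h0
  obtain ⟨k, hk, hk0⟩ := h0 (show (0 : ℝ) ∈ _ by
    constructor
    · linarith
    · have : 0 < (piP p / 2 / s) ^ p := by positivity
      linarith)
  exact ⟨k, hk, hk0⟩

end CosCharacteristic

section CoshCharacteristic

variable {p s : ℝ}

theorem coshP_rpow_neg_lt_one (hp : 1 < p) {t : ℝ} (ht : 0 < t) : coshP p t ^ (-p) < 1 :=
  Real.rpow_lt_one_of_one_lt_of_neg (one_lt_coshP hp ht) (by linarith)

theorem strictMonoOn_coshCharacteristic (hp : 1 < p) (hs : 0 < s) :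
    StrictMonoOn (fun k => k ^ p * (1 - coshP p (k * s) ^ (-p))) (Ici 0) := by
  intro a ha b hb hab
  have ha : 0 ≤ a := ha
  have hp0 : 0 < p := by linarith
  have h1 : coshP p (a * s) < coshP p (b * s) := strictMonoOn_coshP hp (mul_nonneg ha hs.le)
    (mul_nonneg (ha.trans hab.le) hs.le) (mul_lt_mul_of_pos_right hab hs)
  have h2 : coshP p (b * s) ^ (-p) ≤ coshP p (a * s) ^ (-p) :=
    Real.rpow_le_rpow_of_nonpos (by linarith [one_le_coshP hp (a * s)]) h1.le (by linarith)
  have h3 : a ^ p < b ^ p := Real.rpow_lt_rpow ha hab hp0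
  have h4 := coshP_rpow_neg_lt_one hp (mul_pos (ha.trans_lt hab) hs)
  have h5 : 0 ≤ a ^ p := Real.rpow_nonneg ha p
  simp only
  nlinarith

theorem exists_coshCharacteristic_eq (hp : 1 < p) (hs : 0 < s) {B : ℝ} (hB : 0 < B) :
    ∃ k, 0 < k ∧ k ^ p * (1 - coshP p (k * s) ^ (-p)) = B := by
  have hp0 : 0 < p := by linarith
  set a := 1 - coshP p (1 * s) ^ (-p) with ha
  have ha0 : 0 < a := sub_pos.2 (coshP_rpow_neg_lt_one hp (by linarith))
  -- `K ≥ 1` keeps the second factor at least `a`, and `K^p ≥ B / a` then makes the product at least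
  -- `B`.
  set K := max 1 ((B / a) ^ (1 / p)) with hK
  have hK1 : 1 ≤ K := le_max_left _ _
  have hKp : B / a ≤ K ^ p := by
    calc B / a = ((B / a) ^ (1 / p)) ^ p := by
          rw [one_div, Real.rpow_inv_rpow (by positivity) hp0.ne']
      _ ≤ K ^ p := Real.rpow_le_rpow (by positivity) (le_max_right _ _) hp0.le
  have hc : ContinuousOn (fun k => coshP p (k * s) ^ (-p)) (Icc 0 K) :=
    ((continuousOn_coshP_Icc hp (K * s)).comp (by fun_prop) fun k hk =>
      ⟨mul_nonneg hk.1 hs.le, mul_le_mul_of_nonneg_right hk.2 hs.le⟩).rpow_const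
      fun k _ => .inl (zero_lt_one.trans_le (one_le_coshP hp (k * s))).ne'
  have hc' : ContinuousOn (fun k => k ^ p * (1 - coshP p (k * s) ^ (-p))) (Icc 0 K) :=
    (continuousOn_id.rpow_const fun _ _ => .inr hp0.le).mul (continuousOn_const.sub hc)
  obtain ⟨k, hk, hkB⟩ := intermediate_value_Icc (by linarith) hc' (show B ∈ _ by
    constructor
    · simp [Real.zero_rpow hp0.ne', hB.le]
    · have h1 : coshP p (K * s) ^ (-p) ≤ coshP p (1 * s) ^ (-p) :=
        Real.rpow_le_rpow_of_nonpos (by linarith [one_le_coshP hp (1 * s)])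
          ((strictMonoOn_coshP hp).monotoneOn (mul_nonneg zero_le_one hs.le)
            (mul_nonneg (by linarith) hs.le) (mul_le_mul_of_nonneg_right hK1 hs.le)) (by linarith)
      rw [div_le_iff₀ ha0] at hKp
      refine hKp.trans (mul_le_mul_of_nonneg_left ?_ (by positivity))
      rw [ha]
      linarith)
  refine ⟨k, hk.1.lt_of_ne' ?_, hkB⟩
  rintro rfl
  simp [Real.zero_rpow hp0.ne'] at hkB
  linarith

end CoshCharacteristic

/-! ### Scaling between `μ` and `k = (|μ| / (p - 1)) ^ (1 / p)` -/

theorem rpow_one_div_rpow_self {p m : ℝ} (hp : 1 < p) (hm : 0 ≤ m) : (m ^ (1 / p)) ^ p = m := by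
  rw [one_div, Real.rpow_inv_rpow hm (by linarith)]

theorem scale_of_eq {p k : ℝ} (hp : 1 < p) (hk : 0 ≤ k) :
    ((p - 1) * k ^ p / (p - 1)) ^ (1 / p) = k := by
  rw [mul_div_cancel_left₀ _ (by linarith : p - 1 ≠ 0), one_div,
    Real.rpow_rpow_inv hk (by linarith)]

theorem exists_solution_of_pos {p β s : ℝ} (hp : 1 < p) (hs : 0 < s) (hβ : 0 < β) :
    ∃ μ, 0 < μ ∧
      IsClassicalSolution p β s μ (fun x => cosP p ((μ / (p - 1)) ^ (1 / p) * x)) ∧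
      (∀ x ∈ Icc 0 s, 0 < cosP p ((μ / (p - 1)) ^ (1 / p) * x)) ∧
      IsLeast {ν : ℝ | 0 < ν ∧ CosEquation p β s ν} μ := by
  have hp1 : 0 < p - 1 := by linarith
  have hB : 0 < β ^ (p / (p - 1)) := by positivity
  obtain ⟨k, hk, hk0⟩ := exists_cosCharacteristic_eq_zero hp hs hB
  have hks : k * s < piP p / 2 := (lt_div_iff₀ hs).1 hk.2
  have hks0 : 0 < k * s := mul_pos hk.1 hs
  have hpos : ∀ t ∈ Icc 0 (k * s), 0 < cosP p t := fun t ht =>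
    cosP_pos hp ⟨ht.1, ht.2.trans_lt hks⟩
  have hlt : ∀ t ∈ Ioc 0 (k * s), cosP p t < 1 := fun t ht =>
    cosP_lt_one hp ⟨ht.1, ht.2.trans hks.le⟩
  have hkp : 0 < k ^ p := Real.rpow_pos_of_pos hk.1 p
  refine ⟨(p - 1) * k ^ p, by positivity, ?_⟩
  rw [scale_of_eq hp hk.1.le]
  refine ⟨?_, fun x hx => hpos _ ⟨mul_nonneg hk.1.le hx.1,
    mul_le_mul_of_nonneg_left hx.2 hk.1.le⟩, ⟨by positivity, ?_⟩, ?_⟩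
  · have h := isClassicalSolution_of_profile (β := β) (ε := 1) hp hs hk.1 (one_mul 1)
      (by rw [abs_of_pos hβ, one_mul])
      ((continuousOn_cosP hp).mono (Icc_subset_Icc_right hks.le)) (cosP_zero hp) hpos
      (fun t ht => by
        rw [one_mul]
        exact one_sub_rpow_pos hp (hpos t ⟨ht.1.le, ht.2⟩).le (hlt t ht))
      (fun t ht => by
        rw [one_mul, neg_one_mul]
        exact hasDerivAt_cosP hp ⟨ht.1, ht.2.trans hks⟩)
      (by rw [one_mul, abs_of_pos hβ]; linarith)
    rwa [one_mul] at h
  · rw [CosEquation, scale_of_eq hp hk.1.le, mul_div_cancel_left₀ _ hp1.ne',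
      cosEquation_aux hp (hpos _ ⟨hks0.le, le_rfl⟩) (hlt _ ⟨hks0, le_rfl⟩)]
    linarith
  · rintro ν ⟨hν, hνe⟩
    -- A smaller `ν` gives `l < k` in the same quarter period, where strict monotonicity allows no
    -- second root. Roots beyond it are not excluded, hence only minimality.
    by_contra! hcon
    have hm : 0 < ν / (p - 1) := by positivity
    have hl0 : 0 < (ν / (p - 1)) ^ (1 / p) := by positivity
    have hlp := rpow_one_div_rpow_self hp hm.le
    rw [CosEquation] at hνe
    set l := (ν / (p - 1)) ^ (1 / p)
    have hlk : l < k := by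
      rw [← Real.rpow_lt_rpow_iff hl0.le hk.1.le (by linarith : 0 < p), hlp, div_lt_iff₀ hp1]
      linarith
    have hls : l * s < k * s := mul_lt_mul_of_pos_right hlk hs
    have hls0 : 0 < l * s := mul_pos hl0 hs
    rw [cosEquation_aux hp (hpos _ ⟨hls0.le, hls.le⟩) (hlt _ ⟨hls0, hls.le⟩), ← hlp] at hνe
    have := strictMonoOn_cosCharacteristic hp hs hB ⟨hl0.le, (hlk.trans hk.2).le⟩
      ⟨hk.1.le, hk.2.le⟩ hlk
    simp only at this
    linarith

theorem exists_solution_of_neg {p β s : ℝ} (hp : 1 < p) (hs : 0 < s) (hβ : β < 0) :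
    ∃ μ < 0,
      IsClassicalSolution p β s μ (fun x => coshP p ((-μ / (p - 1)) ^ (1 / p) * x)) ∧
      (∀ x ∈ Icc 0 s, 0 < coshP p ((-μ / (p - 1)) ^ (1 / p) * x)) ∧
      CoshEquation p β s μ ∧ ∀ ν < 0, CoshEquation p β s ν → ν = μ := by
  have hp1 : 0 < p - 1 := by linarith
  have hB : 0 < |β| ^ (p / (p - 1)) := Real.rpow_pos_of_pos (abs_pos.2 hβ.ne) _
  obtain ⟨k, hk, hkB⟩ := exists_coshCharacteristic_eq hp hs hB
  have hks : 0 < k * s := mul_pos hk hs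
  have hkp : 0 < k ^ p := Real.rpow_pos_of_pos hk p
  have hpos : ∀ t, 0 < coshP p t := fun t => zero_lt_one.trans_le (one_le_coshP hp t)
  refine ⟨-((p - 1) * k ^ p), neg_neg_of_pos (by positivity), ?_⟩
  rw [CoshEquation, neg_neg, scale_of_eq hp hk.le]
  refine ⟨?_, fun x _ => hpos _, ?_, ?_⟩
  · have h := isClassicalSolution_of_profile (β := β) (ε := -1) hp hs hk (by norm_num)
      (by rw [abs_of_neg hβ]; ring) (continuousOn_coshP_Icc hp _) (coshP_zero hp)
      (fun t _ => hpos t)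
      (fun t ht => by linarith [rpow_sub_one_pos hp (one_lt_coshP hp ht.1)])
      (fun t ht => by
        rw [neg_neg, one_mul, neg_one_mul, neg_sub]
        exact hasDerivAt_coshP hp ht.1)
      (by
        have h1 : coshP p (k * s) ^ (-p) * coshP p (k * s) ^ p = 1 := by
          rw [← Real.rpow_add (hpos _), neg_add_cancel, Real.rpow_zero]
        rw [← hkB]
        linear_combination k ^ p * h1)
    rwa [neg_one_mul, neg_mul] at h
  · rw [mul_div_cancel_left₀ _ hp1.ne', coshEquation_aux hp (one_lt_coshP hp hks)]
    exact hkB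
  · intro ν hν hνe
    have hm : 0 < -ν / (p - 1) := div_pos (by linarith) hp1
    have hl0 : 0 < (-ν / (p - 1)) ^ (1 / p) := by positivity
    have hlp := rpow_one_div_rpow_self hp hm.le
    rw [CoshEquation] at hνe
    set l := (-ν / (p - 1)) ^ (1 / p)
    rw [coshEquation_aux hp (one_lt_coshP hp (mul_pos hl0 hs)), ← hlp, ← hkB] at hνe
    -- Unlike for the cosine, monotonicity holds on the whole half-line, so the root is unique.
    have hlk : l = k := (strictMonoOn_coshCharacteristic hp hs).injOn hl0.le hk.le hνe
    rw [← hlk, hlp]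
    field_simp

theorem isClassicalSolution_one {p s : ℝ} : IsClassicalSolution p 0 s 0 fun _ => 1 :=
  ⟨fun _ => 0, continuousOn_const, fun x _ => hasDerivWithinAt_const x _ _,
    fun x _ => ⟨0, hasDerivAt_const x _, by simp⟩, oddPow_zero p, by simp [oddPow_zero]⟩

end RobinPLap


theorem theorem3p1 (p β s₀ : ℝ) (hp : 1 < p) (hs₀ : 0 < s₀) :
    ∃ μ₁ : ℝ,
      -- smallest eigenvalue
      IsLeast {μ : ℝ | IsEigenvalue p β s₀ μ} μ₁ ∧
      -- variational characterization
      IsGLB (neumannRayleighValues p β s₀) μ₁ ∧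
      IsGLB (rayleighValues p β s₀) μ₁ ∧
      -- first eigenfunctions solve the problem pointwise
      (∀ X : ℝ → ℝ, IsEigenfunction p β s₀ μ₁ X → IsClassicalSolution p β s₀ μ₁ X) ∧
      -- simplicity and constant sign
      (∀ X Y : ℝ → ℝ, IsEigenfunction p β s₀ μ₁ X → IsEigenfunction p β s₀ μ₁ Y →
        ∃ c : ℝ, ∀ s ∈ Set.Icc 0 s₀, Y s = c * X s) ∧
      (∀ X : ℝ → ℝ, IsEigenfunction p β s₀ μ₁ X →
        (∀ s ∈ Set.Icc 0 s₀, 0 < X s) ∨ (∀ s ∈ Set.Icc 0 s₀, X s < 0)) ∧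
      -- sign of the first eigenvalue
      SignType.sign μ₁ = SignType.sign β ∧
      (0 < β →
        IsEigenfunction p β s₀ μ₁ (fun s => cosP p ((μ₁ / (p - 1)) ^ (1 / p) * s)) ∧
        IsLeast {μ : ℝ | 0 < μ ∧ CosEquation p β s₀ μ} μ₁) ∧
      (β < 0 →
        IsEigenfunction p β s₀ μ₁ (fun s => coshP p ((-μ₁ / (p - 1)) ^ (1 / p) * s)) ∧
        (μ₁ < 0 ∧ CoshEquation p β s₀ μ₁) ∧
        ∀ μ : ℝ, μ < 0 → CoshEquation p β s₀ μ → μ = μ₁) := by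

  -- The sign of `β` matters only in choosing the positive solution: `cosh_p`, a constant or
  -- `cos_p`. All remaining claims use just its positivity.
  obtain ⟨μ, X, hX, hpos, hsign, hcos, hcosh⟩ : ∃ (μ : ℝ) (X : ℝ → ℝ),
      IsClassicalSolution p β s₀ μ X ∧ (∀ s ∈ Set.Icc 0 s₀, 0 < X s) ∧
      SignType.sign μ = SignType.sign β ∧
      (0 < β → IsEigenfunction p β s₀ μ (fun s => cosP p ((μ / (p - 1)) ^ (1 / p) * s)) ∧
        IsLeast {μ : ℝ | 0 < μ ∧ CosEquation p β s₀ μ} μ) ∧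
      (β < 0 → IsEigenfunction p β s₀ μ (fun s => coshP p ((-μ / (p - 1)) ^ (1 / p) * s)) ∧
        (μ < 0 ∧ CoshEquation p β s₀ μ) ∧
        ∀ ν : ℝ, ν < 0 → CoshEquation p β s₀ ν → ν = μ) := by
    rcases lt_trichotomy β 0 with hβ | rfl | hβ
    · obtain ⟨μ, hμ, hX, hpos, he, hu⟩ := exists_solution_of_neg hp hs₀ hβ
      exact ⟨μ, _, hX, hpos, by rw [sign_neg hμ, sign_neg hβ], fun h => absurd h hβ.not_gt,
        fun _ => ⟨hX.isEigenfunction hp hs₀ hpos, ⟨hμ, he⟩, hu⟩⟩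
    · exact ⟨0, _, isClassicalSolution_one, fun _ _ => one_pos, rfl,
        fun h => absurd h (lt_irrefl 0), fun h => absurd h (lt_irrefl 0)⟩
    · obtain ⟨μ, hμ, hX, hpos, hl⟩ := exists_solution_of_pos hp hs₀ hβ
      exact ⟨μ, _, hX, hpos, by rw [sign_pos hμ, sign_pos hβ],
        fun _ => ⟨hX.isEigenfunction hp hs₀ hpos, hl⟩, fun h => absurd h hβ.not_gt⟩
  refine ⟨μ, hX.isLeast_eigenvalue hp hs₀ hpos,
    (hX.isLeast_neumannRayleighValues hp hs₀ hpos).isGLB,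
    (hX.isLeast_rayleighValues hp hs₀ hpos).isGLB, fun Y hY => ?_, fun Y Z hY hZ => ?_,
    fun Y hY => ?_, hsign, hcos, hcosh⟩
  · obtain ⟨c, -, hc⟩ := hX.eigenfunction_eq_const_mul hp hs₀ hpos hY
    exact (hX.const_mul c).congr hs₀ hc
  · obtain ⟨c, hc0, hc⟩ := hX.eigenfunction_eq_const_mul hp hs₀ hpos hY
    obtain ⟨d, -, hd⟩ := hX.eigenfunction_eq_const_mul hp hs₀ hpos hZ
    refine ⟨d / c, fun s hs => ?_⟩
    rw [hc s hs, hd s hs]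
    field_simp
  · obtain ⟨c, hc0, hc⟩ := hX.eigenfunction_eq_const_mul hp hs₀ hpos hY
    rcases hc0.lt_or_gt with h | h
    · exact .inr fun s hs => hc s hs ▸ mul_neg_of_neg_of_pos h (hpos s hs)
    · exact .inl fun s hs => hc s hs ▸ mul_pos h (hpos s hs)
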